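/- **Setting.** Let $\delta>0$, and let $\beta:\mathbb R\to\mathbb R$ be smooth with $\beta_0\le\beta(t)\le\beta_1$ for all $t\in\mathbb R$, where $0<\beta_0\le\beta_1$ are constants. For $\lambda\in\mathbb R$ consider the Stratonovich equation $$\frac{dx}{dt}=\lambda x-\beta(t)x^3+\delta x\circ\frac{d\omega}{dt},\qquad x(\tau)=x_\tau,\quad t>\tau, \tag{1}$$ where $\omega$ is a two-sided Wiener process, realized on $\{\omega\in C(\mathbb R,\mathbb R):\omega(0)=0\}$ with the compact-open topology, its Borel $\sigma$-algebra and the Wiener measure $P$, with the shift $\theta_t\omega=\omega(\cdot+t)-\omega(t)$. Let $\Omega$ be the set of those $\omega$ with $\omega(t)/t\to0$ as $t\to\pm\infty$ and $\int_{-\infty}^0e^{2\delta\omega(s)}ds=\int_0^\infty e^{2\delta\omega(s)}ds=\infty$; it is $\theta_t$-invariant. Then $\Omega$ is measurable with $P(\Omega)=1$, and for each $\lambda$ equation (1) generates exactly one continuous cocycle $\Phi=\Phi_\lambda$ on $\mathbb R$ over $(\Omega,\{\theta_t\})$ by $\Phi(t,\tau,\omega,x_\tau)=x(t+\tau,\tau,\theta_{-\tau}\omega,x_\tau)$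 for $t\ge0$, where $x(\cdot,\tau,\cdot,x_\tau)$ is a continuous adapted process that solves (1) (the Stratonovich integral being the limit in probability of the trapezoidal sums) and that for every $\omega\in\Omega$ solves (1) pathwise, i.e. $\frac{d}{dt}\big(e^{-\delta\omega(t)}x(t)\big)=e^{-\delta\omega(t)}\big(\lambda x(t)-\beta(t)x(t)^3\big)$ for $t\ge\tau$. **Terminology.** A map $\xi:\mathbb R\times\Omega\to\mathbb R$ is a *complete quasi-solution* of (1) if $\Phi(t,\tau,\omega,\xi(\tau,\omega))=\xi(\tau+t,\theta_t\omega)$ for all $t\ge0$, $\tau\in\mathbb R$, $\omega\in\Omega$. It is a *random periodic solution with period $T>0$* (*random almost periodic*, *random almost automorphic solution*) if moreover, for every $\omega$, the function $\tau\mapsto\xi(\tau,\omega)$ is $T$-periodic (almost periodic, almost automorphic). Here $f:\mathbb R\to\mathbb R$ is almost periodic if for every $\varepsilon>0$ there is $l>0$ such that every interval of length $l$ contains a $t_0$ with $|f(\tau+t_0)-f(\tau)|<\varepsilon$ for all $\tau$; it is almost automorphic if every real sequence has a subsequence $(\tau_m)$ for which there is $\zeta:\mathbb R\to\mathbb R$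 with $f(\tau+\tau_m)\to\zeta(\tau)$ and $\zeta(\tau-\tau_m)\to f(\tau)$ for all $\tau$. The fixed point $0$ of $\Phi$ is *pullback Lyapunov stable in $\mathbb R$* if for all $\tau,\omega$ and $\varepsilon>0$ there is $\eta>0$ with $|\Phi(t,\tau-t,\theta_{-t}\omega,x)|<\varepsilon$ for all $t\ge0$, $|x|<\eta$; otherwise it is *pullback Lyapunov unstable*. It is *pullback asymptotically stable in $\mathbb R$* if it is pullback Lyapunov stable and $\Phi(t,\tau-t,\theta_{-t}\omega,x)\to0$ as $t\to\infty$ for all $\tau,\omega$ and $x\in\mathbb R$. Let $\mathcal D$ be the collection of all families $D=\{D(\tau,\omega)\}_{\tau\in\mathbb R,\,\omega\in\Omega}$ of bounded nonempty subsets of $\mathbb R$ that are tempered: $\lim_{t\to-\infty}e^{ct}\sup\{|x|:x\in D(\tau+t,\theta_t\omega)\}=0$ for all $c>0$, $\tau$, $\omega$. With $d(S,A)=\sup_{x\in S}\inf_{a\in A}|x-a|$, a *$\mathcal D$-pullback attractor* is a family $\mathcal A\in\mathcal D$ of compact sets, measurable in $\omega$ (that is, $\omega\mapsto\inf_{a\in\mathcal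 A(\tau,\omega)}|x-a|$ is measurable for all $\tau,x$), with $\Phi(t,\tau,\omega,\mathcal A(\tau,\omega))=\mathcal A(\tau+t,\theta_t\omega)$ for all $t\ge0,\tau,\omega$, and with $d\big(\Phi(t,\tau-t,\theta_{-t}\omega,B(\tau-t,\theta_{-t}\omega)),\mathcal A(\tau,\omega)\big)\to0$ as $t\to\infty$ for all $B\in\mathcal D$, $\tau$, $\omega$. A map $\xi$ *pullback attracts* a set $K\subseteq\mathbb R$ if $d(\Phi(t,\tau-t,\theta_{-t}\omega,K),\{\xi(\tau,\omega)\})\to0$ as $t\to\infty$ for all $\tau,\omega$. **Theorem.** Suppose in addition that $\beta$ is periodic with period $T>0$ (respectively almost periodic, almost automorphic). Then the random periodic (respectively almost periodic, almost automorphic) solutions of (1) undergo a stochastic pitchfork bifurcation at $\lambda=0$: (i) If $\lambda\le0$, then $x=0$ is a random periodic solution with period $T$ (respectively random almost periodic, random almost automorphic solution) of (1), it is the only random periodic (of any period), almost periodic or almost automorphic solution, and it is pullback asymptotically stable in $\mathbb R$. In this case (1) has the trivial $\mathcal D$-pullback attractor $\mathcal A(\tau,\omega)=\{0\}$. (ii)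 If $\lambda>0$, then the zero solution is pullback Lyapunov unstable in $\mathbb R$, and there are two more random periodic solutions with period $T$ (respectively random almost periodic, random almost automorphic solutions) $x_\lambda^+>0$ and $x_\lambda^-<0$, measurable in $\omega$, such that $$\lim_{\lambda\to0^+}x_\lambda^\pm(\tau,\omega)=0\qquad\text{for all }\tau\in\mathbb R,\ \omega\in\Omega .$$ In this case (1) has the $\mathcal D$-pullback attractor $\mathcal A(\tau,\omega)=[x_\lambda^-(\tau,\omega),x_\lambda^+(\tau,\omega)]$; moreover $x_\lambda^+$ and $x_\lambda^-$ pullback attract every compact subset of $(0,\infty)$ and of $(-\infty,0)$, respectively. -/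

import Mathlib

open MeasureTheory ProbabilityTheory Filter Set
open scoped Topology NNReal ENNReal

noncomputable section

/-! ### Wiener space, the Wiener measure and the shift -/

/-- Continuous real functions on the line that vanish at `0`. -/
def WienerSpace : Type := {ω : C(ℝ, ℝ) // ω 0 = 0}

namespace WienerSpace

/-- The compact-open topology. -/
instance : TopologicalSpace WienerSpace :=
  inferInstanceAs (TopologicalSpace {ω : C(ℝ, ℝ) // ω 0 = 0})

/-- The Borel `σ`-algebra of the compact-open topology. -/
instance : MeasurableSpace WienerSpace := borel WienerSpace

instance : BorelSpace WienerSpace := ⟨rfl⟩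

instance : CoeFun WienerSpace (fun _ => ℝ → ℝ) := ⟨fun ω => ω.1⟩

/-- `(θ_t ω)(s) = ω(s + t) - ω(t)`. -/
def shift (t : ℝ) (ω : WienerSpace) : WienerSpace :=
  ⟨⟨fun s => ω (s + t) - ω t,
    (ω.1.continuous.comp (continuous_id.add continuous_const)).sub continuous_const⟩, by
      change ω (0 + t) - ω t = 0
      rw [zero_add, sub_self]⟩

theorem shift_apply (t s : ℝ) (ω : WienerSpace) : shift t ω s = ω (s + t) - ω t := rfl

end WienerSpace

/-- `P` is the Wiener measure: under `P` the coordinate process (which is continuous and vanishes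
at time `0`) is a two-sided Brownian motion. -/
structure IsWienerMeasure (P : Measure WienerSpace) : Prop where
  isProbabilityMeasure : IsProbabilityMeasure P
  hasLaw_increment : ∀ s t : ℝ, s ≤ t →
    HasLaw (fun ω : WienerSpace => ω t - ω s) (gaussianReal 0 (t - s).toNNReal) P
  hasIndepIncrements : HasIndepIncrements (fun (t : ℝ) (ω : WienerSpace) => ω t) P

/-- The paths of sublinear growth for which the two exponential functionals diverge. -/
def regularPaths (δ : ℝ) : Set WienerSpace :=
  {ω | Tendsto (fun t : ℝ => ω t / t) atTop (𝓝 0) ∧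
    Tendsto (fun t : ℝ => ω t / t) atBot (𝓝 0) ∧
    (∫⁻ s in Iic (0 : ℝ), ENNReal.ofReal (Real.exp (2 * δ * ω s))) = ∞ ∧
    (∫⁻ s in Ici (0 : ℝ), ENNReal.ofReal (Real.exp (2 * δ * ω s))) = ∞}

theorem WienerSpace.continuous_coe (ω : WienerSpace) : Continuous (ω : ℝ → ℝ) := ω.1.continuous

theorem tendsto_shift_div {l : Filter ℝ} (hl : Tendsto (fun s : ℝ => s⁻¹) l (𝓝 0))
    (h0 : ∀ᶠ s in l, s ≠ 0) (t : ℝ) (h1 : ∀ᶠ s in l, s + t ≠ 0)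
    (hs : Tendsto (fun s => s + t) l l) {ω : WienerSpace}
    (h : Tendsto (fun s : ℝ => ω s / s) l (𝓝 0)) :
    Tendsto (fun s : ℝ => WienerSpace.shift t ω s / s) l (𝓝 0) := by
  have h2 : Tendsto (fun s : ℝ => ω (s + t) / (s + t) * (1 + t * s⁻¹) - ω t * s⁻¹) l
      (𝓝 (0 * (1 + t * 0) - ω t * 0)) :=
    ((h.comp hs).mul (tendsto_const_nhds.add (hl.const_mul t))).sub (hl.const_mul (ω t))
  have h3 : (0 : ℝ) * (1 + t * 0) - ω t * 0 = 0 := by ring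
  rw [h3] at h2
  refine h2.congr' ?_
  filter_upwards [h0, h1] with s hs0 hs1
  rw [WienerSpace.shift_apply]
  field_simp

theorem lintegral_shift_eq_top {δ : ℝ} (t : ℝ) {ω : WienerSpace} {S : Set ℝ}
    (K : Set ℝ) (hK : IsCompact K)
    (hSK : S ⊆ (fun s => s - t) ⁻¹' S ∪ K)
    (h : (∫⁻ s in S, ENNReal.ofReal (Real.exp (2 * δ * ω s))) = ∞) :
    (∫⁻ s in S, ENNReal.ofReal (Real.exp (2 * δ * WienerSpace.shift t ω s))) = ∞ := by
  have hc : Continuous (fun s => Real.exp (2 * δ * ω s)) :=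
    Real.continuous_exp.comp (continuous_const.mul ω.continuous_coe)
  have e1 : ∀ s, ENNReal.ofReal (Real.exp (2 * δ * WienerSpace.shift t ω s)) =
      ENNReal.ofReal (Real.exp (-(2 * δ * ω t))) *
        ENNReal.ofReal (Real.exp (2 * δ * ω (s + t))) := by
    intro s
    rw [← ENNReal.ofReal_mul (Real.exp_pos _).le, ← Real.exp_add, WienerSpace.shift_apply]
    congr 2
    ring
  simp_rw [e1]
  rw [lintegral_const_mul' _ _ ENNReal.ofReal_ne_top]
  have e2 : (∫⁻ s in S, ENNReal.ofReal (Real.exp (2 * δ * ω (s + t)))) =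
      ∫⁻ s in (fun s => s - t) ⁻¹' S, ENNReal.ofReal (Real.exp (2 * δ * ω s)) := by
    have := (measurePreserving_add_right (volume : Measure ℝ) t).setLIntegral_comp_preimage_emb
      (measurableEmbedding_addRight t) (fun s => ENNReal.ofReal (Real.exp (2 * δ * ω s)))
      ((fun s => s - t) ⁻¹' S)
    rw [← this]
    congr 2
    ext s
    simp
  rw [e2]
  have hfin : (∫⁻ s in K, ENNReal.ofReal (Real.exp (2 * δ * ω s))) ≠ ∞ :=
    (hc.continuousOn.integrableOn_compact hK).lintegral_lt_top.ne
  have htop : (∫⁻ s in (fun s => s - t) ⁻¹' S, ENNReal.ofReal (Real.exp (2 * δ * ω s))) = ∞ := by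
    by_contra hne
    have h4 := (lintegral_mono_set (f := fun s => ENNReal.ofReal (Real.exp (2 * δ * ω s)))
      (μ := volume) hSK).trans (lintegral_union_le _ _ _)
    rw [h] at h4
    exact (ENNReal.add_ne_top.2 ⟨hne, hfin⟩) (top_le_iff.1 h4)
  rw [htop, ENNReal.mul_top]
  exact (ENNReal.ofReal_pos.2 (Real.exp_pos _)).ne'

theorem shift_mem_regularPaths {δ : ℝ} (t : ℝ) {ω : WienerSpace} (h : ω ∈ regularPaths δ) :
    WienerSpace.shift t ω ∈ regularPaths δ := by
  obtain ⟨h1, h2, h3, h4⟩ := h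
  refine ⟨?_, ?_, ?_, ?_⟩
  · exact tendsto_shift_div tendsto_inv_atTop_zero (eventually_ne_atTop 0) t
      ((tendsto_atTop_add_const_right _ t tendsto_id).eventually (eventually_ne_atTop 0))
      (tendsto_atTop_add_const_right _ t tendsto_id) h1
  · exact tendsto_shift_div tendsto_inv_atBot_zero (eventually_ne_atBot 0) t
      ((tendsto_atBot_add_const_right _ t tendsto_id).eventually (eventually_ne_atBot 0))
      (tendsto_atBot_add_const_right _ t tendsto_id) h2
  · refine lintegral_shift_eq_top t (Icc t 0) isCompact_Icc ?_ h3
    intro s hs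
    rcases le_total s t with hst | hst
    · exact Or.inl (by simpa using hst)
    · exact Or.inr ⟨hst, hs⟩
  · refine lintegral_shift_eq_top t (Icc 0 t) isCompact_Icc ?_ h4
    intro s hs
    rcases le_total t s with hst | hst
    · exact Or.inl (by simpa using hst)
    · exact Or.inr ⟨hs, hst⟩

/-- The sample space: the regular paths, with the `σ`-algebra inherited from Wiener space. -/
abbrev SamplePath (δ : ℝ) : Type := {ω : WienerSpace // ω ∈ regularPaths δ}

/-- The Wiener measure, carried by the sample space. -/
def sampleMeasure (P : Measure WienerSpace) (δ : ℝ) : Measure (SamplePath δ) :=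
  P.comap Subtype.val

/-- The shift `θ_t` on the sample space. -/
def SamplePath.shift {δ : ℝ} (t : ℝ) (ω : SamplePath δ) : SamplePath δ :=
  ⟨WienerSpace.shift t ω.1, shift_mem_regularPaths t ω.2⟩

/-! ### The Stratonovich equation `dx = (λ x - β(t) x³) dt + δ x ∘ dω` -/

/-- `I = ∫_a^b Y ∘ dω`: along every sequence of partitions `a = p n 0 ≤ ⋯ ≤ p n (N n) = b` of
`[a, b]` with mesh tending to `0`, the trapezoidal sums converge to `I` in probability. -/
def HasStratonovichIntegral {δ : ℝ} (Q : Measure (SamplePath δ)) (Y : ℝ → SamplePath δ → ℝ)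
    (a b : ℝ) (I : SamplePath δ → ℝ) : Prop :=
  ∀ (N : ℕ → ℕ) (p : ℕ → ℕ → ℝ),
    (∀ n, Monotone (p n) ∧ p n 0 = a ∧ p n (N n) = b) →
    (∀ ε > 0, ∀ᶠ n in atTop, ∀ i < N n, p n (i + 1) - p n i < ε) →
    TendstoInMeasure Q
      (fun n ω => ∑ i ∈ Finset.range (N n),
        (Y (p n i) ω + Y (p n (i + 1)) ω) / 2 * (ω.1 (p n (i + 1)) - ω.1 (p n i)))
      atTop I

/-- The `σ`-algebra generated by the increments of the noise on `[τ, t]`. -/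
@[reducible] def incrementSigma (δ τ t : ℝ) : MeasurableSpace (SamplePath δ) :=
  ⨆ s ∈ Icc τ t, MeasurableSpace.comap (fun ω : SamplePath δ => ω.1 s - ω.1 τ) inferInstance

/-- `X` is a continuous adapted solution on `[τ, ∞)` of the Stratonovich equation
`dx = (λ x - β(t) x³) dt + δ x ∘ dω` with `x(τ) = x₀`. -/
structure IsStratonovichSolution {δ : ℝ} (Q : Measure (SamplePath δ)) (β : ℝ → ℝ) (lam τ x₀ : ℝ)
    (X : ℝ → SamplePath δ → ℝ) : Prop where
  initial : ∀ ω, X τ ω = x₀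
  continuous : ∀ ω, ContinuousOn (fun t => X t ω) (Ici τ)
  adapted : ∀ t ≥ τ, Measurable[incrementSigma δ τ t] (X t)
  integral_eq : ∀ t ≥ τ, HasStratonovichIntegral Q (fun s ω => δ * X s ω) τ t
    (fun ω => X t ω - x₀ - ∫ s in τ..t, (lam * X s ω - β s * X s ω ^ 3))

/-- The same equation along one fixed path `ω`. As the noise is linear, the Stratonovich product
rule turns `dx = f(t, x) dt + δ x ∘ dω` into `d(e^{-δ ω} x) = e^{-δ ω} f(t, x) dt`, which has a
meaning for each continuous `ω`. -/
structure IsPathwiseSolution {δ : ℝ} (β : ℝ → ℝ) (lam τ x₀ : ℝ) (ω : SamplePath δ)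
    (x : ℝ → ℝ) : Prop where
  initial : x τ = x₀
  hasDeriv : ∀ t ≥ τ, HasDerivWithinAt (fun s => Real.exp (-δ * ω.1 s) * x s)
    (Real.exp (-δ * ω.1 t) * (lam * x t - β t * x t ^ 3)) (Ici τ) t

/-! ### Cocycles, quasi-solutions, stability, attractors on the state space `ℝ` -/

/-- The type of the maps `(t, τ, ω, x) ↦ Φ(t, τ, ω, x)`. -/
abbrev CocycleMap (δ : ℝ) : Type := ℝ≥0 → ℝ → SamplePath δ → ℝ → ℝ

/-- Continuous cocycles over the shift. -/
structure IsContinuousCocycle {δ : ℝ} (Φ : CocycleMap δ) : Prop where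
  measurable : ∀ τ, Measurable (fun p : ℝ≥0 × SamplePath δ × ℝ => Φ p.1 τ p.2.1 p.2.2)
  zero : ∀ τ ω x, Φ 0 τ ω x = x
  add : ∀ (t s : ℝ≥0) τ ω x, Φ (t + s) τ ω x = Φ t (τ + s) (ω.shift s) (Φ s τ ω x)
  continuous : ∀ t τ ω, Continuous (Φ t τ ω)

/-- `Φ` is the continuous cocycle generated by `dx = (λ x - β(t) x³) dt + δ x ∘ dω`:
the solution `x(t, τ, ω, x₀)` that starts at time `τ` in `x₀` is `Φ(t - τ, τ, θ_τ ω, x₀)`.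
It solves the Stratonovich equation, and the version is the one that solves the equation along
every path. -/
structure IsGeneratedCocycle {δ : ℝ} (Q : Measure (SamplePath δ)) (β : ℝ → ℝ) (lam : ℝ)
    (Φ : CocycleMap δ) : Prop where
  cocycle : IsContinuousCocycle Φ
  stratonovich : ∀ τ x₀, IsStratonovichSolution Q β lam τ x₀
    (fun t ω => Φ (t - τ).toNNReal τ (ω.shift τ) x₀)
  pathwise : ∀ τ x₀ ω, IsPathwiseSolution β lam τ x₀ ω
    (fun t => Φ (t - τ).toNNReal τ (ω.shift τ) x₀)

/-- Complete quasi-solutions. -/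
def IsCompleteQuasiSolution {δ : ℝ} (Φ : CocycleMap δ) (ξ : ℝ → SamplePath δ → ℝ) : Prop :=
  ∀ (t : ℝ≥0) τ ω, Φ t τ ω (ξ τ ω) = ξ (τ + t) (ω.shift t)

/-- Bohr almost periodic functions. -/
def IsAlmostPeriodic (f : ℝ → ℝ) : Prop :=
  ∀ ε > 0, ∃ l > 0, ∀ a : ℝ, ∃ t₀ ∈ Icc a (a + l), ∀ τ, |f (τ + t₀) - f τ| < ε

/-- Almost automorphic functions. -/
def IsAlmostAutomorphic (f : ℝ → ℝ) : Prop :=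
  ∀ u : ℕ → ℝ, ∃ k : ℕ → ℕ, StrictMono k ∧ ∃ ζ : ℝ → ℝ, ∀ τ,
    Tendsto (fun m => f (τ + u (k m))) atTop (𝓝 (ζ τ)) ∧
    Tendsto (fun m => ζ (τ - u (k m))) atTop (𝓝 (f τ))

/-- The three types of recurrence. -/
inductive RecurrenceType : Type
  | periodic (T : ℝ)
  | almostPeriodic
  | almostAutomorphic

/-- `f` has the given type of recurrence. -/
def RecurrenceType.Holds : RecurrenceType → (ℝ → ℝ) → Prop
  | .periodic T, f => 0 < T ∧ Function.Periodic f T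
  | .almostPeriodic, f => IsAlmostPeriodic f
  | .almostAutomorphic, f => IsAlmostAutomorphic f

/-- Random periodic (almost periodic, almost automorphic) solutions: complete quasi-solutions
whose sample functions `τ ↦ ξ(τ, ω)` all have the type of recurrence `κ`. -/
def IsRecurrentSolution {δ : ℝ} (κ : RecurrenceType) (Φ : CocycleMap δ)
    (ξ : ℝ → SamplePath δ → ℝ) : Prop :=
  IsCompleteQuasiSolution Φ ξ ∧ ∀ ω, κ.Holds (fun τ => ξ τ ω)

/-- Fixed points of the cocycle. -/
def IsFixedPoint {δ : ℝ} (Φ : CocycleMap δ) (x₀ : ℝ) : Prop :=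
  ∀ t τ ω, Φ t τ ω x₀ = x₀

/-- Pullback Lyapunov stability of the point `x₀` in `E`. -/
def PullbackLyapunovStable {δ : ℝ} (Φ : CocycleMap δ) (E : Set ℝ) (x₀ : ℝ) : Prop :=
  ∀ (τ : ℝ) (ω : SamplePath δ), ∀ ε > 0, ∃ η > 0, ∀ t : ℝ≥0,
    Φ t (τ - t) (ω.shift (-t)) '' (Metric.ball x₀ η ∩ E) ⊆ Metric.ball x₀ ε ∩ E

/-- `x₀` is a fixed point that is pullback Lyapunov unstable in `E`. -/
def IsPullbackUnstableFixedPoint {δ : ℝ} (Φ : CocycleMap δ) (E : Set ℝ) (x₀ : ℝ) : Prop :=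
  IsFixedPoint Φ x₀ ∧ ¬ PullbackLyapunovStable Φ E x₀

/-- `x₀` is a fixed point that is pullback asymptotically stable in `E`. -/
def IsPullbackAsympStableFixedPoint {δ : ℝ} (Φ : CocycleMap δ) (E : Set ℝ) (x₀ : ℝ) : Prop :=
  IsFixedPoint Φ x₀ ∧ PullbackLyapunovStable Φ E x₀ ∧
    ∀ (τ : ℝ) (ω : SamplePath δ), ∀ x ∈ E, Tendsto (fun t : ℝ≥0 => Φ t (τ - t) (ω.shift (-t)) x) atTop (𝓝 x₀)

/-- The collection `𝒟` of tempered families of bounded nonempty subsets of `ℝ`. -/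
structure IsTempered {δ : ℝ} (D : ℝ → SamplePath δ → Set ℝ) : Prop where
  nonempty : ∀ τ ω, (D τ ω).Nonempty
  bounded : ∀ τ ω, Bornology.IsBounded (D τ ω)
  tendsto : ∀ c > 0, ∀ (τ : ℝ) (ω : SamplePath δ), Tendsto
    (fun t : ℝ => Real.exp (c * t) * sSup ((fun x => |x|) '' D (τ + t) (ω.shift t))) atBot (𝓝 0)

/-- The Hausdorff semi-distance `sup_{x ∈ S} inf_{a ∈ A} |x - a|`. -/
def hausdorffSemiDist (S A : Set ℝ) : ℝ≥0∞ := ⨆ x ∈ S, Metric.infEDist x A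

/-- `A` is a `𝒟`-pullback attractor, `𝒟` being the collection of tempered families. -/
structure IsPullbackAttractor {δ : ℝ} (Φ : CocycleMap δ) (A : ℝ → SamplePath δ → Set ℝ) :
    Prop where
  tempered : IsTempered A
  measurable : ∀ τ x, Measurable (fun ω => Metric.infDist x (A τ ω))
  compact : ∀ τ ω, IsCompact (A τ ω)
  invariant : ∀ (t : ℝ≥0) τ ω, Φ t τ ω '' A τ ω = A (τ + t) (ω.shift t)
  attracts : ∀ B, IsTempered B → ∀ (τ : ℝ) (ω : SamplePath δ), Tendsto
    (fun t : ℝ≥0 => hausdorffSemiDist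
      (Φ t (τ - t) (ω.shift (-t)) '' B (τ - t) (ω.shift (-t))) (A τ ω)) atTop (𝓝 0)

/-- `ξ` pullback attracts every compact subset of `U`. -/
def PullbackAttractsCompacts {δ : ℝ} (Φ : CocycleMap δ) (ξ : ℝ → SamplePath δ → ℝ) (U : Set ℝ) :
    Prop :=
  ∀ K ⊆ U, IsCompact K → ∀ (τ : ℝ) (ω : SamplePath δ), Tendsto
    (fun t : ℝ≥0 => hausdorffSemiDist (Φ t (τ - t) (ω.shift (-t)) '' K) {ξ τ ω}) atTop (𝓝 0)

end

/-! ### Measurability of path functionals -/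

/-! The equation is of Bernoulli type: formally `x⁻²` satisfies a linear equation, so along each
path there is an explicit flow `bernoulliFlow`. That it solves the pathwise equation is a
differentiation, since `e^{-δω}x` is continuously differentiable in time. Pathwise uniqueness
follows from monotonicity of the cubic, so every generated cocycle equals `bernoulliCocycle`. The
Stratonovich equation holds because the trapezoidal error is controlled by the mesh and the cubic
variation of the noise, and the latter vanishes in probability.

Started at time `τ - t`, the flow has at time `τ` the value `y / √(1 + 2y²K)` with `y = x e^{λt -
δω(-t)}` and `K = ∫_{-t}^0 β(τ+r) e^{2(λr+δω(r))} dr` (`bernoulliCocycle_pullback`). Its modulus is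
at most `1/√(2K)`, uniformly in `x`, and everything depends on the behaviour of `K` as `t → ∞`.

If `λ ≤ 0`, then `K ≥ β₀ ∫_{-t}^0 e^{2δω} → ∞` by the choice of the paths. All initial data are
pulled to `0` uniformly, which gives stability, the trivial attractor and the vanishing of every
complete quasi-solution.

If `λ > 0`, sublinear growth of `ω` makes `K` converge to a finite `M(τ, ω)` while `|y| → ∞` for `x
≠ 0`. The pullback limits are thus `±1/√(2M)`, the two new equilibria. Monotonicity of the flow and
the uniform bound yield the attractor. In `M` the time `τ` enters only through `β(τ+r)`, integrated
against a fixed integrable kernel, so the recurrence of `β` passes to the equilibria. The divergence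
of `∫_{-∞}^0 e^{2δω}` forces `M → ∞` as `λ → 0+`.

The path set has full measure: sublinear growth comes from fourth moments, dyadic chaining and
Borel–Cantelli, and divergence of the exponential functionals from a zero-one law and the mean time
spent in a half-line. -/

theorem WienerSpace.measurable_eval (t : ℝ) : Measurable (fun ω : WienerSpace => ω t) :=
  Continuous.measurable (α := WienerSpace) <|
    (continuous_eval_const (F := C(ℝ, ℝ)) t).comp continuous_subtype_val

theorem SamplePath.measurable_eval {δ : ℝ} (t : ℝ) :
    Measurable (fun ω : SamplePath δ => ω.1 t) :=
  (WienerSpace.measurable_eval t).comp measurable_subtype_coe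

theorem SamplePath.continuous_coe {δ : ℝ} (ω : SamplePath δ) : Continuous (ω.1 : ℝ → ℝ) :=
  ω.1.continuous_coe

theorem SamplePath.apply_zero {δ : ℝ} (ω : SamplePath δ) : ω.1 0 = 0 := ω.1.2

theorem SamplePath.shift_apply {δ : ℝ} (t s : ℝ) (ω : SamplePath δ) :
    (ω.shift t).1 s = ω.1 (s + t) - ω.1 t := rfl

theorem SamplePath.measurable_uncurry {δ : ℝ} :
    Measurable (fun p : ℝ × SamplePath δ => p.2.1 p.1) :=
  measurable_uncurry_of_continuous_of_measurable (u := fun (t : ℝ) (ω : SamplePath δ) => ω.1 t)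
    (fun ω => ω.continuous_coe) (fun t => SamplePath.measurable_eval t)

theorem measurable_integral_of_continuous {Ω : Type*} [MeasurableSpace Ω] {f : ℝ → Ω → ℝ}
    (hc : ∀ ω, Continuous (fun s => f s ω)) (hm : ∀ s, Measurable (f s))
    (μ : Measure ℝ) [SFinite μ] : Measurable (fun ω => ∫ s, f s ω ∂μ) := by
  have h : Measurable (Function.uncurry f) :=
    measurable_uncurry_of_continuous_of_measurable hc hm
  have h2 : StronglyMeasurable (Function.uncurry (fun ω s => f s ω)) :=
    (h.comp measurable_swap).stronglyMeasurable
  exact h2.integral_prod_right.measurable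

theorem measurable_lintegral_of_continuous {Ω : Type*} [MeasurableSpace Ω] {f : ℝ → Ω → ℝ}
    (hc : ∀ ω, Continuous (fun s => f s ω)) (hm : ∀ s, Measurable (f s))
    (μ : Measure ℝ) [SFinite μ] : Measurable (fun ω => ∫⁻ s, ENNReal.ofReal (f s ω) ∂μ) := by
  have h : Measurable (Function.uncurry f) :=
    measurable_uncurry_of_continuous_of_measurable hc hm
  exact (ENNReal.measurable_ofReal.comp (h.comp measurable_swap)).lintegral_prod_right'

/-- Measurability is assumed only for times in `[a, b]`, since in the proof of adaptedness the
`σ`-algebra knows nothing of other times. Projecting the time variable onto `[a, b]` reduces this to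
the case of all times. -/
theorem measurable_intervalIntegral_of_continuous {Ω : Type*} [MeasurableSpace Ω] {f : ℝ → Ω → ℝ}
    {a b : ℝ} (hab : a ≤ b)
    (hc : ∀ ω, Continuous (fun s => f s ω)) (hm : ∀ s ∈ Icc a b, Measurable (f s)) :
    Measurable (fun ω => ∫ s in a..b, f s ω) := by
  have h : ∀ ω, ∫ s in a..b, f s ω = ∫ s in Ioc a b, f (projIcc a b hab s) ω := by
    intro ω
    rw [intervalIntegral.integral_of_le hab]
    refine setIntegral_congr_fun measurableSet_Ioc fun s hs => ?_
    simp [projIcc_of_mem hab (Ioc_subset_Icc_self hs)]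
  simp_rw [h]
  exact measurable_integral_of_continuous (f := fun s ω => f (projIcc a b hab s) ω)
    (fun ω => (hc ω).comp (continuous_subtype_val.comp continuous_projIcc))
    (fun s => hm _ (projIcc a b hab s).2) _

/-! ### The explicit solution of the Bernoulli equation -/

/-- The integrand of Bernoulli's formula for the coefficient `b` and the driving path `w`. -/
noncomputable def bernoulliWeight (δ lam : ℝ) (b w : ℝ → ℝ) (s : ℝ) : ℝ :=
  b s * Real.exp (2 * (lam * s + δ * w s))

/-- Bernoulli's formula for the solution at time `t` that starts at time `0` in `x`. -/
noncomputable def bernoulliFlow (δ lam : ℝ) (b w : ℝ → ℝ) (t x : ℝ) : ℝ :=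
  x * Real.exp (lam * t + δ * w t) /
    √(1 + 2 * x ^ 2 * ∫ s in (0 : ℝ)..t, bernoulliWeight δ lam b w s)

/-- The cocycle given by Bernoulli's formula along each path of the noise. -/
noncomputable def bernoulliCocycle {δ : ℝ} (β : ℝ → ℝ) (lam : ℝ) : CocycleMap δ :=
  fun t τ ω x => bernoulliFlow δ lam (fun s => β (τ + s)) (fun s => ω.1 s) t x

section Flow

variable {δ lam : ℝ} {b w : ℝ → ℝ}

theorem bernoulliWeight_pos (hpos : ∀ s, 0 < b s) (s : ℝ) : 0 < bernoulliWeight δ lam b w s :=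
  mul_pos (hpos s) (Real.exp_pos _)

theorem continuous_bernoulliWeight (hb : Continuous b) (hw : Continuous w) :
    Continuous (bernoulliWeight δ lam b w) := by
  unfold bernoulliWeight
  fun_prop

theorem integral_bernoulliWeight_nonneg (hpos : ∀ s, 0 < b s) {s t : ℝ} (h : s ≤ t) :
    0 ≤ ∫ r in s..t, bernoulliWeight δ lam b w r :=
  intervalIntegral.integral_nonneg h fun r _ => (bernoulliWeight_pos hpos r).le

theorem bernoulliFlow_denom_pos (hpos : ∀ s, 0 < b s) {t : ℝ} (ht : 0 ≤ t) (x : ℝ) :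
    0 < 1 + 2 * x ^ 2 * ∫ s in (0 : ℝ)..t, bernoulliWeight δ lam b w s := by
  have := integral_bernoulliWeight_nonneg (δ := δ) (lam := lam) (w := w) hpos ht
  positivity

theorem bernoulliFlow_sq (hpos : ∀ s, 0 < b s) {t : ℝ} (ht : 0 ≤ t) (x : ℝ) :
    bernoulliFlow δ lam b w t x ^ 2 = x ^ 2 * Real.exp (2 * (lam * t + δ * w t)) /
      (1 + 2 * x ^ 2 * ∫ s in (0 : ℝ)..t, bernoulliWeight δ lam b w s) := by
  rw [bernoulliFlow, div_pow, Real.sq_sqrt (bernoulliFlow_denom_pos hpos ht x).le, mul_pow,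
    ← Real.exp_nat_mul]
  norm_num

/-- The weight of the shifted data is a rescaled shift of the weight. -/
theorem bernoulliWeight_shift (s r : ℝ) :
    bernoulliWeight δ lam (fun u => b (s + u)) (fun u => w (u + s) - w s) r =
      Real.exp (-(2 * (lam * s + δ * w s))) * bernoulliWeight δ lam b w (r + s) := by
  simp only [bernoulliWeight]
  rw [mul_left_comm, ← Real.exp_add, add_comm s r]
  congr 2
  ring

/-- The denominators telescope: inserting the square of the state at time `s` turns the second
denominator into `(1 + 2x²J) / (1 + 2x²I)`, where `I` and `J` are the weight integrals up to `s` and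
`t + s`. -/
theorem bernoulliFlow_add (hb : Continuous b) (hw : Continuous w) (hpos : ∀ s, 0 < b s)
    {t s : ℝ} (hs : 0 ≤ s) (x : ℝ) :
    bernoulliFlow δ lam b w (t + s) x =
      bernoulliFlow δ lam (fun r => b (s + r)) (fun r => w (r + s) - w s) t
        (bernoulliFlow δ lam b w s x) := by
  have hc := continuous_bernoulliWeight (δ := δ) (lam := lam) hb hw
  have hJ : (∫ r in (0 : ℝ)..t,
      bernoulliWeight δ lam (fun u => b (s + u)) (fun u => w (u + s) - w s) r) =
      Real.exp (-(2 * (lam * s + δ * w s))) *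
        ((∫ r in (0 : ℝ)..(t + s), bernoulliWeight δ lam b w r) -
          ∫ r in (0 : ℝ)..s, bernoulliWeight δ lam b w r) := by
    simp_rw [bernoulliWeight_shift]
    rw [intervalIntegral.integral_const_mul, intervalIntegral.integral_comp_add_right
      (bernoulliWeight δ lam b w), zero_add, intervalIntegral.integral_interval_sub_left
      (hc.intervalIntegrable _ _) (hc.intervalIntegrable _ _)]
  have hD := bernoulliFlow_denom_pos (δ := δ) (lam := lam) (w := w) hpos hs x
  have hsq := bernoulliFlow_sq (δ := δ) (lam := lam) (w := w) hpos hs x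
  conv_rhs => rw [bernoulliFlow]
  rw [hJ, hsq, bernoulliFlow, bernoulliFlow]
  set I := ∫ r in (0 : ℝ)..s, bernoulliWeight δ lam b w r
  set J := ∫ r in (0 : ℝ)..(t + s), bernoulliWeight δ lam b w r with hJdef
  have e1 : 1 + 2 * (x ^ 2 * Real.exp (2 * (lam * s + δ * w s)) / (1 + 2 * x ^ 2 * I)) *
      (Real.exp (-(2 * (lam * s + δ * w s))) * (J - I)) =
      (1 + 2 * x ^ 2 * J) / (1 + 2 * x ^ 2 * I) := by
    rw [Real.exp_neg]
    field_simp
    ring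
  rw [e1, Real.sqrt_div' _ hD.le]
  have e2 : Real.exp (lam * (t + s) + δ * w (t + s)) =
      Real.exp (lam * s + δ * w s) * Real.exp (lam * t + δ * (w (t + s) - w s)) := by
    rw [← Real.exp_add]
    congr 1
    ring
  have h3 : 0 < √(1 + 2 * x ^ 2 * I) := Real.sqrt_pos.2 hD
  rw [e2]
  generalize √(1 + 2 * x ^ 2 * I) = R at h3 ⊢
  field_simp

theorem continuous_bernoulliFlow (hpos : ∀ s, 0 < b s) {t : ℝ} (ht : 0 ≤ t) :
    Continuous (bernoulliFlow δ lam b w t) := by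
  unfold bernoulliFlow
  refine Continuous.div (by fun_prop) (by fun_prop) fun x => ?_
  exact (Real.sqrt_pos.2 (bernoulliFlow_denom_pos hpos ht x)).ne'

theorem bernoulliFlow_zero (t : ℝ) : bernoulliFlow δ lam b w t 0 = 0 := by simp [bernoulliFlow]

theorem bernoulliFlow_neg (t x : ℝ) :
    bernoulliFlow δ lam b w t (-x) = -bernoulliFlow δ lam b w t x := by
  simp [bernoulliFlow, neg_div]

end Flow

/-! ### The Bernoulli cocycle as the unique pathwise solution -/

section Cocycle

variable {δ lam : ℝ} {β : ℝ → ℝ}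

theorem bernoulliCocycle_isContinuousCocycle (hβ : Continuous β) (hpos : ∀ s, 0 < β s) :
    IsContinuousCocycle (bernoulliCocycle (δ := δ) β lam) where
  measurable τ := by
    -- The substitution `s = t u` moves the variable upper limit `t` into the integrand, so that the
    -- integration is over the fixed interval `[0, 1]`.
    have hI : Measurable (fun p : ℝ≥0 × SamplePath δ × ℝ => ∫ u in (0 : ℝ)..1,
        bernoulliWeight δ lam (fun s => β (τ + s)) (fun s => p.2.1.1 s) (p.1 * u)) := by
      refine measurable_intervalIntegral_of_continuous zero_le_one (f := fun u
        (p : ℝ≥0 × SamplePath δ × ℝ) => bernoulliWeight δ lam (fun s => β (τ + s))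
          (fun s => p.2.1.1 s) (p.1 * u)) (fun p => ?_) (fun u _ => ?_)
      · exact (continuous_bernoulliWeight (by fun_prop) p.2.1.continuous_coe).comp (by fun_prop)
      · have h1 : Measurable (fun p : ℝ≥0 × SamplePath δ × ℝ => p.2.1.1 (p.1 * u)) :=
          SamplePath.measurable_uncurry.comp
            (f := fun p : ℝ≥0 × SamplePath δ × ℝ => ((p.1 : ℝ) * u, p.2.1)) (by fun_prop)
        have := hβ.measurable
        unfold bernoulliWeight
        fun_prop
    have h1 : Measurable (fun p : ℝ≥0 × SamplePath δ × ℝ => p.2.1.1 p.1) :=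
      SamplePath.measurable_uncurry.comp
        (f := fun p : ℝ≥0 × SamplePath δ × ℝ => ((p.1 : ℝ), p.2.1)) (by fun_prop)
    have h2 : ∀ p : ℝ≥0 × SamplePath δ × ℝ, ∫ s in (0 : ℝ)..p.1,
        bernoulliWeight δ lam (fun s => β (τ + s)) (fun s => p.2.1.1 s) s =
        p.1 * ∫ u in (0 : ℝ)..1,
          bernoulliWeight δ lam (fun s => β (τ + s)) (fun s => p.2.1.1 s) (p.1 * u) := by
      intro p
      have := intervalIntegral.smul_integral_comp_mul_left (a := 0) (b := 1)
        (bernoulliWeight δ lam (fun s => β (τ + s)) (fun s => p.2.1.1 s)) p.1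
      rw [smul_eq_mul, mul_zero, mul_one] at this
      exact this.symm
    unfold bernoulliCocycle bernoulliFlow
    simp_rw [h2]
    fun_prop
  zero τ ω x := by simp [bernoulliCocycle, bernoulliFlow, ω.apply_zero]
  add t s τ ω x := by
    have := bernoulliFlow_add (δ := δ) (lam := lam) (b := fun s => β (τ + s)) (w := fun s => ω.1 s)
      (t := t) (by fun_prop) ω.continuous_coe (fun s => hpos _) s.2 x
    simp only [bernoulliCocycle, SamplePath.shift_apply, NNReal.coe_add]
    simpa only [add_assoc] using! this
  continuous t τ ω := continuous_bernoulliFlow (fun s => hpos _) t.2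

/-- The solution through `(τ, x₀)` along the path `ω`, in terms of `s = t - τ`. -/
theorem bernoulliCocycle_shift_apply {t τ : ℝ} (ht : τ ≤ t) (ω : SamplePath δ) (x₀ : ℝ) :
    bernoulliCocycle β lam (t - τ).toNNReal τ (ω.shift τ) x₀ =
      x₀ * Real.exp (lam * (t - τ) + δ * (ω.1 t - ω.1 τ)) / √(1 + 2 * x₀ ^ 2 *
        ∫ s in (0 : ℝ)..(t - τ), bernoulliWeight δ lam (fun s => β (τ + s))
          (fun s => ω.1 (s + τ) - ω.1 τ) s) := by
  simp only [bernoulliCocycle, bernoulliFlow, Real.coe_toNNReal _ (sub_nonneg.2 ht),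
    SamplePath.shift_apply, sub_add_cancel]

/-- The factor `e^{-δω(t)}` cancels the only factor of the formula that need not be differentiable
in `t`. What remains is an exponential divided by the square root of a function with continuous
derivative. -/
theorem bernoulliCocycle_isPathwiseSolution (hβ : Continuous β) (hpos : ∀ s, 0 < β s)
    (τ x₀ : ℝ) (ω : SamplePath δ) : IsPathwiseSolution β lam τ x₀ ω
      (fun t => bernoulliCocycle β lam (t - τ).toNNReal τ (ω.shift τ) x₀) where
  initial := by simp [bernoulliCocycle, bernoulliFlow, SamplePath.shift_apply]
  hasDeriv := by
    intro t ht
    have hω := ω.continuous_coe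
    set W := bernoulliWeight δ lam (fun s => β (τ + s)) (fun s => ω.1 (s + τ) - ω.1 τ) with hW
    have hWc : Continuous W := continuous_bernoulliWeight (by fun_prop) (by fun_prop)
    have hD : ∀ {u : ℝ}, 0 ≤ u → 0 < 1 + 2 * x₀ ^ 2 * ∫ s in (0 : ℝ)..u, W s := fun hu =>
      bernoulliFlow_denom_pos (δ := δ) (lam := lam) (w := fun s => ω.1 (s + τ) - ω.1 τ)
        (fun s => hpos (τ + s)) hu x₀
    have hDt := hD (sub_nonneg.2 ht)
    have hs : 0 < √(1 + 2 * x₀ ^ 2 * ∫ s in (0 : ℝ)..(t - τ), W s) := Real.sqrt_pos.2 hDt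
    have hsub : HasDerivAt (fun u => u - τ) 1 t := (hasDerivAt_id t).sub_const τ
    have hI : HasDerivAt (fun u => ∫ s in (0 : ℝ)..(u - τ), W s) (W (t - τ)) t := by
      have := (hWc.integral_hasStrictDerivAt 0 (t - τ)).hasDerivAt.comp t hsub
      rwa [mul_one] at this
    have hden := ((hI.const_mul (2 * x₀ ^ 2)).const_add 1).sqrt hDt.ne'
    have hnum := ((hsub.const_mul lam).exp).const_mul (Real.exp (-δ * ω.1 τ) * x₀)
    have hmain := (hnum.div hden hs.ne').hasDerivWithinAt (s := Ici τ)
    have heq : ∀ u ∈ Ici τ, Real.exp (-δ * ω.1 u) *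
        bernoulliCocycle β lam (u - τ).toNNReal τ (ω.shift τ) x₀ =
        Real.exp (-δ * ω.1 τ) * x₀ * Real.exp (lam * (u - τ)) /
          √(1 + 2 * x₀ ^ 2 * ∫ s in (0 : ℝ)..(u - τ), W s) := by
      intro u hu
      rw [bernoulliCocycle_shift_apply hu, ← hW]
      have : Real.exp (-δ * ω.1 τ) * x₀ * Real.exp (lam * (u - τ)) =
          Real.exp (-δ * ω.1 u) * (x₀ * Real.exp (lam * (u - τ) + δ * (ω.1 u - ω.1 τ))) := by
        rw [mul_right_comm, mul_comm x₀, ← mul_assoc, ← Real.exp_add, ← Real.exp_add]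
        congr 2
        ring
      rw [this]
      ring
    refine (hmain.congr heq (heq t ht)).congr_deriv ?_
    rw [bernoulliCocycle_shift_apply ht, ← hW]
    set D := 1 + 2 * x₀ ^ 2 * ∫ s in (0 : ℝ)..(t - τ), W s with hDdef
    have hWt : W (t - τ) = β t * Real.exp (lam * (t - τ) + δ * (ω.1 t - ω.1 τ)) ^ 2 := by
      rw [← Real.exp_nat_mul]
      simp [hW, bernoulliWeight]
    have hE : Real.exp (-δ * ω.1 τ) * Real.exp (lam * (t - τ)) =
        Real.exp (-δ * ω.1 t) * Real.exp (lam * (t - τ) + δ * (ω.1 t - ω.1 τ)) := by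
      rw [← Real.exp_add, ← Real.exp_add]
      congr 1
      ring
    have hsq : √D ^ 2 = D := Real.sq_sqrt hDt.le
    rw [hWt]
    set E := Real.exp (lam * (t - τ) + δ * (ω.1 t - ω.1 τ))
    set A := Real.exp (-δ * ω.1 τ)
    set F := Real.exp (lam * (t - τ))
    set G := Real.exp (-δ * ω.1 t)
    set S := √D
    clear_value S E A F G
    simp only [mul_one]
    field_simp
    linear_combination x₀ * (S ^ 2 * lam - β t * E ^ 2 * x₀ ^ 2) * hE

/-- The nonlinearity is dissipative: `(x - y)(x³ - y³) ≥ 0`. The weight `e^{-2λs}` absorbs the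
linear term, so the weighted squared difference is nonincreasing from `0`; no local Lipschitz
argument is needed. -/
theorem IsPathwiseSolution.eq_of_same_initial {τ x₀ : ℝ} (hpos : ∀ s, 0 < β s) {ω : SamplePath δ}
    {x y : ℝ → ℝ} (hx : IsPathwiseSolution β lam τ x₀ ω x) (hy : IsPathwiseSolution β lam τ x₀ ω y)
    {t : ℝ} (ht : τ ≤ t) : x t = y t := by
  set v : ℝ → ℝ := fun s => (Real.exp (-δ * ω.1 s) * x s - Real.exp (-δ * ω.1 s) * y s) ^ 2 *
    Real.exp (-2 * lam * s) with hv
  have hder : ∀ s ≥ τ, HasDerivWithinAt v (-2 * β s * Real.exp (-δ * ω.1 s) ^ 2 *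
      Real.exp (-2 * lam * s) * ((x s - y s) * (x s ^ 3 - y s ^ 3))) (Ici τ) s := by
    intro s hs
    have h1 := ((hx.hasDeriv s hs).sub (hy.hasDeriv s hs)).pow 2
    have h2 : HasDerivWithinAt (fun s => Real.exp (-2 * lam * s))
        (Real.exp (-2 * lam * s) * (-2 * lam * 1)) (Ici τ) s :=
      (((hasDerivAt_id s).const_mul (-2 * lam)).exp).hasDerivWithinAt
    refine (h1.mul h2).congr_deriv ?_
    simp only [Pi.sub_apply, Pi.pow_apply]
    push_cast
    ring
  have hanti : AntitoneOn v (Ici τ) := by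
    refine antitoneOn_of_deriv_nonpos (convex_Ici τ)
      (fun s hs => (hder s hs).continuousWithinAt) (fun s hs => ?_) (fun s hs => ?_)
    · exact ((hder s (interior_subset hs)).mono interior_subset).differentiableWithinAt
    · rw [interior_Ici] at hs
      rw [((hder s (le_of_lt hs)).hasDerivAt (Ici_mem_nhds hs)).deriv]
      have h1 : 0 ≤ (x s - y s) * (x s ^ 3 - y s ^ 3) := by
        have : (x s - y s) * (x s ^ 3 - y s ^ 3) =
            (x s - y s) ^ 2 * ((x s + y s) ^ 2 + x s ^ 2 + y s ^ 2) / 2 := by ring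
        rw [this]
        positivity
      have h2 : 0 ≤ 2 * β s * Real.exp (-δ * ω.1 s) ^ 2 * Real.exp (-2 * lam * s) := by
        have := hpos s
        positivity
      nlinarith [mul_nonneg h2 h1]
  have h0 : v t ≤ 0 := by
    have := hanti self_mem_Ici ht ht
    simpa [hv, hx.initial, hy.initial] using this
  have h1 : (Real.exp (-δ * ω.1 t) * x t - Real.exp (-δ * ω.1 t) * y t) ^ 2 ≤ 0 := by
    by_contra hcon
    exact absurd h0 (not_le.2 (mul_pos (not_le.1 hcon) (Real.exp_pos _)))
  have h2 : Real.exp (-δ * ω.1 t) * (x t - y t) = 0 := by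
    rw [mul_sub]
    exact pow_eq_zero_iff two_ne_zero |>.1 (le_antisymm h1 (sq_nonneg _))
  exact sub_eq_zero.1 ((mul_eq_zero.1 h2).resolve_left (Real.exp_pos _).ne')

theorem SamplePath.shift_shift_neg (τ : ℝ) (ω : SamplePath δ) : (ω.shift (-τ)).shift τ = ω := by
  apply Subtype.ext
  apply Subtype.ext
  ext s
  change (ω.1 (s + τ + -τ) - ω.1 (-τ)) - (ω.1 (τ + -τ) - ω.1 (-τ)) = ω.1 s
  simp [ω.apply_zero]

theorem IsGeneratedCocycle.eq_bernoulliCocycle {Q : Measure (SamplePath δ)} (hβ : Continuous β)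
    (hpos : ∀ s, 0 < β s) {Φ : CocycleMap δ} (h : IsGeneratedCocycle Q β lam Φ) :
    Φ = bernoulliCocycle β lam := by
  funext t τ ω x
  -- The solution along a path evaluates the cocycle at the path shifted by `τ`; starting from the
  -- path shifted by `-τ` reaches an arbitrary `ω`.
  have := (h.pathwise τ x (ω.shift (-τ))).eq_of_same_initial hpos
    (bernoulliCocycle_isPathwiseSolution hβ hpos τ x (ω.shift (-τ)))
    (t := τ + t) (le_add_of_nonneg_right t.2)
  simpa [SamplePath.shift_shift_neg] using this

theorem measurable_increment {τ t s : ℝ} (hs : s ∈ Icc τ t) :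
    Measurable[incrementSigma δ τ t] (fun ω : SamplePath δ => ω.1 s - ω.1 τ) := by
  refine Measurable.mono (comap_measurable _) ?_ le_rfl
  exact le_iSup₂ (f := fun s (_ : s ∈ Icc τ t) => MeasurableSpace.comap
    (fun ω : SamplePath δ => ω.1 s - ω.1 τ) inferInstance) s hs

/-- The solution formula sees the noise only through the increments `ω(s) - ω(τ)` with `s ∈ [τ, t]`.
-/
theorem bernoulliCocycle_adapted (hβ : Continuous β) {τ t : ℝ} (ht : τ ≤ t) (x₀ : ℝ) :
    Measurable[incrementSigma δ τ t] (fun ω : SamplePath δ =>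
      bernoulliCocycle β lam (t - τ).toNNReal τ (ω.shift τ) x₀) := by
  simp_rw [bernoulliCocycle_shift_apply ht]
  have h1 := measurable_increment (δ := δ) (right_mem_Icc.2 ht)
  have h2 : Measurable[incrementSigma δ τ t] (fun ω : SamplePath δ =>
      ∫ s in (0 : ℝ)..(t - τ), bernoulliWeight δ lam (fun s => β (τ + s))
        (fun s => ω.1 (s + τ) - ω.1 τ) s) := by
    refine @measurable_intervalIntegral_of_continuous _ (incrementSigma δ τ t)
      (fun s ω => bernoulliWeight δ lam (fun s => β (τ + s)) (fun s => ω.1 (s + τ) - ω.1 τ) s)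
      0 (t - τ) (sub_nonneg.2 ht) (fun ω => ?_) (fun s hs => ?_)
    · have := ω.continuous_coe
      exact continuous_bernoulliWeight (by fun_prop) (by fun_prop)
    · have h3 := measurable_increment (δ := δ) (τ := τ) (t := t) (s := s + τ)
        ⟨by linarith [hs.1], by linarith [hs.2]⟩
      unfold bernoulliWeight
      exact ((h3.const_mul δ |>.const_add _ |>.const_mul _).exp).const_mul _
  have h4 := ((h1.const_mul δ).const_add (lam * (t - τ))).exp.const_mul x₀
  exact h4.div ((h2.const_mul (2 * x₀ ^ 2)).const_add 1).sqrt

end Cocycle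

/-! ### Trapezoidal sums along a single path -/

/-- The trapezoidal rule is exact to second order. After division by `e^x` the error is the
third-order Taylor remainder of `e^u` minus `u/2` times the second-order one, and `2/9 + 3/8 < 1`.
-/
theorem abs_exp_sub_trapezoid_le {x y : ℝ} (h : |y - x| ≤ 1) :
    |Real.exp y - Real.exp x - (Real.exp x + Real.exp y) / 2 * (y - x)| ≤
      Real.exp x * |y - x| ^ 3 := by
  set u := y - x with hu
  have hy : Real.exp y = Real.exp x * Real.exp u := by
    rw [← Real.exp_add, hu]
    congr 1
    ring
  have h2 := Real.exp_bound h (n := 2) (by norm_num)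
  have h3 := Real.exp_bound h (n := 3) (by norm_num)
  simp only [Finset.sum_range_succ, Finset.sum_range_zero, Nat.factorial] at h2 h3
  norm_num at h2 h3
  have e : Real.exp y - Real.exp x - (Real.exp x + Real.exp y) / 2 * u =
      Real.exp x * ((Real.exp u - (1 + u + u ^ 2 / 2)) - (Real.exp u - (1 + u)) * u / 2) := by
    rw [hy]
    ring
  rw [e, abs_mul, abs_of_pos (Real.exp_pos x)]
  refine mul_le_mul_of_nonneg_left ?_ (Real.exp_pos x).le
  refine (abs_sub _ _).trans ?_
  have h5 : |(Real.exp u - (1 + u)) * u / 2| ≤ u ^ 2 * (3 / 4) * |u| / 2 := by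
    rw [abs_div, abs_mul, abs_two]
    gcongr
  have h6 : u ^ 2 = |u| ^ 2 := (sq_abs u).symm
  rw [h6] at h5
  nlinarith [pow_nonneg (abs_nonneg u) 3]

/-- One cell of the partition, for `x = E z` with `E = e^{δw}` rough and `z` continuously
differentiable. Two parts of the error are `η` times the cell length and sum to something small; the
third is cubic in the increment of `w`. -/
theorem abs_trapezoid_error_le {δ s t M η : ℝ} {w z z' : ℝ → ℝ} (hst : s ≤ t) (hw : Continuous w)
    (hz' : ContinuousOn z' (Icc s t)) (hz : z t - z s = ∫ r in s..t, z' r)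
    (hE : ∀ r ∈ Icc s t, |Real.exp (δ * w r)| ≤ M) (hM : ∀ r ∈ Icc s t, |z r| ≤ M)
    (hM' : ∀ r ∈ Icc s t, |z' r| ≤ M)
    (hη : ∀ r ∈ Icc s t, ∀ r' ∈ Icc s t,
      |Real.exp (δ * w r) - Real.exp (δ * w r')| ≤ η)
    (h1 : |δ * w t - δ * w s| ≤ 1) :
    |Real.exp (δ * w t) * z t - Real.exp (δ * w s) * z s -
        (∫ r in s..t, Real.exp (δ * w r) * z' r) -
        (δ * (Real.exp (δ * w s) * z s) + δ * (Real.exp (δ * w t) * z t)) / 2 * (w t - w s)| ≤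
      2 * η * M * (t - s) + M ^ 2 * |δ| ^ 3 * |w t - w s| ^ 3 := by
  have hs : s ∈ Icc s t := left_mem_Icc.2 hst
  have ht : t ∈ Icc s t := right_mem_Icc.2 hst
  have hM0 : 0 ≤ M := (abs_nonneg _).trans (hM s hs)
  have hη0 : 0 ≤ η := (abs_nonneg _).trans (hη s hs t ht)
  have hi1 : IntervalIntegrable z' volume s t :=
    (hz'.mono (uIcc_of_le hst).subset).intervalIntegrable
  have hi2 : IntervalIntegrable (fun r => Real.exp (δ * w r) * z' r) volume s t := by
    refine ContinuousOn.intervalIntegrable ?_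
    rw [uIcc_of_le hst]
    exact (Continuous.continuousOn (by fun_prop)).mul hz'
  set E := fun r => Real.exp (δ * w r) with hEdef
  have eA : (E s + E t) / 2 * (z t - z s) - (∫ r in s..t, E r * z' r) =
      ∫ r in s..t, ((E s + E t) / 2 - E r) * z' r := by
    rw [hz, ← intervalIntegral.integral_const_mul, ← intervalIntegral.integral_sub
      (hi1.const_mul _) hi2]
    congr 1
    ext r
    ring
  have bA : |∫ r in s..t, ((E s + E t) / 2 - E r) * z' r| ≤ η * M * (t - s) := by
    have := intervalIntegral.norm_integral_le_of_norm_le_const (a := s) (b := t) (C := η * M)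
      (f := fun r => ((E s + E t) / 2 - E r) * z' r) (fun r hr => ?_)
    · simpa [abs_of_nonneg (sub_nonneg.2 hst)] using this
    · rw [uIoc_of_le hst] at hr
      have hr' := Ioc_subset_Icc_self hr
      rw [Real.norm_eq_abs, abs_mul]
      refine mul_le_mul ?_ (hM' r hr') (abs_nonneg _) hη0
      have e : (E s + E t) / 2 - E r = ((E s - E r) + (E t - E r)) / 2 := by ring
      rw [e, abs_div, abs_two]
      have := abs_add_le (E s - E r) (E t - E r)
      have h2 := hη s hs r hr'
      have h3 := hη t ht r hr'
      linarith
  have bZ : |z t - z s| ≤ M * (t - s) := by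
    rw [hz]
    have := intervalIntegral.norm_integral_le_of_norm_le_const (a := s) (b := t) (C := M)
      (f := z') (fun r hr => ?_)
    · simpa [abs_of_nonneg (sub_nonneg.2 hst)] using this
    · rw [uIoc_of_le hst] at hr
      exact hM' r (Ioc_subset_Icc_self hr)
  have bB : |(z s + z t) / 2 * (E t - E s - (E s + E t) / 2 * (δ * w t - δ * w s))| ≤
      M ^ 2 * |δ| ^ 3 * |w t - w s| ^ 3 := by
    rw [abs_mul]
    have h2 : |(z s + z t) / 2| ≤ M := by
      rw [abs_div, abs_two]
      have := abs_add_le (z s) (z t)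
      have h3 := hM s hs
      have h4 := hM t ht
      linarith
    have h3 := abs_exp_sub_trapezoid_le h1
    have h4 : Real.exp (δ * w s) ≤ M := (le_abs_self _).trans (hE s hs)
    have h5 : |δ * w t - δ * w s| ^ 3 = |δ| ^ 3 * |w t - w s| ^ 3 := by
      rw [← mul_sub, abs_mul, mul_pow]
    rw [h5] at h3
    calc _ ≤ M * (M * (|δ| ^ 3 * |w t - w s| ^ 3)) :=
          mul_le_mul h2 (h3.trans (mul_le_mul_of_nonneg_right h4 (by positivity)))
            (abs_nonneg _) hM0
      _ = _ := by ring
  have bC : |(E t - E s) * (z t - z s) * (δ * w t - δ * w s) / 4| ≤ η * M * (t - s) := by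
    rw [abs_div, abs_mul, abs_mul]
    have h2 : |E t - E s| * |z t - z s| * |δ * w t - δ * w s| ≤ η * (M * (t - s)) * 1 :=
      mul_le_mul (mul_le_mul (hη t ht s hs) bZ (abs_nonneg _) hη0) h1 (abs_nonneg _)
        (mul_nonneg hη0 (mul_nonneg hM0 (sub_nonneg.2 hst)))
    have h3 : |(4 : ℝ)| = 4 := by norm_num
    have h4 : 0 ≤ η * M * (t - s) := mul_nonneg (mul_nonneg hη0 hM0) (sub_nonneg.2 hst)
    rw [h3]
    linarith
  -- Discrete product rule `Δ(Ez) = Ē Δz + z̄ ΔE`, where bars are endpoint averages, together with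
  -- `avg(Ez) = Ē z̄ + ΔE Δz / 4`.
  have key : E t * z t - E s * z s - (∫ r in s..t, E r * z' r) -
      (δ * (E s * z s) + δ * (E t * z t)) / 2 * (w t - w s) =
      (∫ r in s..t, ((E s + E t) / 2 - E r) * z' r) +
      (z s + z t) / 2 * (E t - E s - (E s + E t) / 2 * (δ * w t - δ * w s)) -
      (E t - E s) * (z t - z s) * (δ * w t - δ * w s) / 4 := by
    rw [← eA]
    ring
  change |E t * z t - E s * z s - (∫ r in s..t, E r * z' r) -
      (δ * (E s * z s) + δ * (E t * z t)) / 2 * (w t - w s)| ≤ _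
  rw [key]
  refine (abs_sub _ _).trans ?_
  have := abs_add_le (∫ r in s..t, ((E s + E t) / 2 - E r) * z' r)
    ((z s + z t) / 2 * (E t - E s - (E s + E t) / 2 * (δ * w t - δ * w s)))
  linarith

/-- If the cubic variation vanishes along a sequence of partitions, the trapezoidal sums of
`δ e^{δ w} z` with respect to `w` converge. -/
theorem tendsto_trapezoidal_sum {δ a b : ℝ} (hab : a ≤ b) {w z z' : ℝ → ℝ} (hw : Continuous w)
    (hz : ∀ t ≥ a, HasDerivWithinAt z (z' t) (Ici a) t) (hz' : ContinuousOn z' (Ici a))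
    {N : ℕ → ℕ} {p : ℕ → ℕ → ℝ} (hp : ∀ n, Monotone (p n) ∧ p n 0 = a ∧ p n (N n) = b)
    (hmesh : ∀ ε > 0, ∀ᶠ n in atTop, ∀ i < N n, p n (i + 1) - p n i < ε)
    (h3 : Tendsto (fun n => ∑ i ∈ Finset.range (N n), |w (p n (i + 1)) - w (p n i)| ^ 3)
      atTop (𝓝 0)) :
    Tendsto (fun n => ∑ i ∈ Finset.range (N n), (δ * (Real.exp (δ * w (p n i)) * z (p n i)) +
        δ * (Real.exp (δ * w (p n (i + 1))) * z (p n (i + 1)))) / 2 *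
          (w (p n (i + 1)) - w (p n i)))
      atTop (𝓝 (Real.exp (δ * w b) * z b - Real.exp (δ * w a) * z a -
        ∫ s in a..b, Real.exp (δ * w s) * z' s)) := by
  have hzc : ContinuousOn z (Ici a) := fun t ht => (hz t ht).continuousWithinAt
  have hsub : Icc a b ⊆ Ici a := Icc_subset_Ici_self
  have hEc : ContinuousOn (fun r => Real.exp (δ * w r)) (Icc a b) :=
    Continuous.continuousOn (by fun_prop)
  obtain ⟨M1, hM1⟩ := isCompact_Icc.exists_bound_of_continuousOn hEc
  obtain ⟨M2, hM2⟩ := isCompact_Icc.exists_bound_of_continuousOn (hzc.mono hsub)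
  obtain ⟨M3, hM3⟩ := isCompact_Icc.exists_bound_of_continuousOn (hz'.mono hsub)
  set M := max M1 (max M2 M3) with hM
  have hM0 : 0 ≤ M := ((norm_nonneg _).trans (hM1 a (left_mem_Icc.2 hab))).trans (le_max_left _ _)
  rw [Metric.tendsto_atTop']
  intro ε hε
  obtain ⟨η, hη0, hη⟩ : ∃ η > 0, 2 * η * M * (b - a) < ε / 2 := by
    refine ⟨ε / (4 * (M * (b - a) + 1)), by positivity, ?_⟩
    have h0 : 0 ≤ M * (b - a) := mul_nonneg hM0 (sub_nonneg.2 hab)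
    have e : 2 * (ε / (4 * (M * (b - a) + 1))) * M * (b - a) =
        ε / 2 * (M * (b - a) / (M * (b - a) + 1)) := by
      field_simp
      ring
    rw [e]
    refine mul_lt_of_lt_one_right (by positivity) ?_
    rw [div_lt_one (by positivity)]
    linarith
  obtain ⟨d1, hd1, hu1⟩ := Metric.uniformContinuousOn_iff.1
    (isCompact_Icc.uniformContinuousOn_of_continuous hEc) η hη0
  obtain ⟨d2, hd2, hu2⟩ := Metric.uniformContinuousOn_iff.1
    (isCompact_Icc.uniformContinuousOn_of_continuous
      (f := fun r => δ * w r) (s := Icc a b) (Continuous.continuousOn (by fun_prop))) 1 one_pos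
  have h4 : Tendsto (fun n => M ^ 2 * |δ| ^ 3 * ∑ i ∈ Finset.range (N n),
      |w (p n (i + 1)) - w (p n i)| ^ 3) atTop (𝓝 0) := by
    simpa using h3.const_mul (M ^ 2 * |δ| ^ 3)
  have h5 := (hmesh (min d1 d2) (lt_min hd1 hd2)).and
    (h4.eventually (gt_mem_nhds (half_pos hε)))
  obtain ⟨n₀, hn₀⟩ := eventually_atTop.1 h5
  refine ⟨n₀, fun n hn => ?_⟩
  obtain ⟨hm, hcub⟩ := hn₀ n hn.le
  obtain ⟨hmono, hp0, hpN⟩ := hp n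
  have hmem : ∀ i < N n, Icc (p n i) (p n (i + 1)) ⊆ Icc a b := fun i hi =>
    Icc_subset_Icc (hp0 ▸ hmono (Nat.zero_le i)) (hpN ▸ hmono hi)
  have hint : (∑ i ∈ Finset.range (N n), ∫ s in (p n i)..(p n (i + 1)),
      Real.exp (δ * w s) * z' s) = ∫ s in a..b, Real.exp (δ * w s) * z' s := by
    rw [intervalIntegral.sum_integral_adjacent_intervals (f := fun s => Real.exp (δ * w s) * z' s)
      (a := p n), hp0, hpN]
    intro i hi
    refine ContinuousOn.intervalIntegrable ?_
    rw [uIcc_of_le (hmono (Nat.le_succ i))]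
    exact (hEc.mul (hz'.mono hsub)).mono (hmem i hi)
  have htel : (∑ i ∈ Finset.range (N n), (Real.exp (δ * w (p n (i + 1))) * z (p n (i + 1)) -
      Real.exp (δ * w (p n i)) * z (p n i))) =
      Real.exp (δ * w b) * z b - Real.exp (δ * w a) * z a := by
    rw [Finset.sum_range_sub (fun i => Real.exp (δ * w (p n i)) * z (p n i)), hp0, hpN]
  have htel2 : (∑ i ∈ Finset.range (N n), (p n (i + 1) - p n i)) = b - a := by
    rw [Finset.sum_range_sub, hp0, hpN]
  rw [dist_comm, Real.dist_eq, ← hint, ← htel, ← Finset.sum_sub_distrib, ← Finset.sum_sub_distrib]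
  refine (Finset.abs_sum_le_sum_abs _ _).trans_lt ?_
  refine (Finset.sum_le_sum (g := fun i => 2 * η * M * (p n (i + 1) - p n i) +
    M ^ 2 * |δ| ^ 3 * |w (p n (i + 1)) - w (p n i)| ^ 3) (fun i hi => ?_)).trans_lt ?_
  · have hi := Finset.mem_range.1 hi
    have hle : p n i ≤ p n (i + 1) := hmono (Nat.le_succ i)
    have hI := hmem i hi
    have hmi := hm i hi
    have hsm : p n i ∈ Icc a b := hI (left_mem_Icc.2 hle)
    refine abs_trapezoid_error_le (δ := δ) (w := w) (z := z) (z' := z') hle hw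
      (hz'.mono (hI.trans hsub)) ?_ (fun r hr => (hM1 r (hI hr)).trans (le_max_left _ _))
      (fun r hr => (hM2 r (hI hr)).trans ((le_max_left _ _).trans (le_max_right _ _)))
      (fun r hr => (hM3 r (hI hr)).trans ((le_max_right _ _).trans (le_max_right _ _)))
      (fun r hr r' hr' => ?_) ?_
    · refine (intervalIntegral.integral_eq_sub_of_hasDeriv_right_of_le hle
        (hzc.mono (hI.trans hsub)) (fun r hr => ?_) ?_).symm
      · have hra : a ≤ r := hsm.1.trans hr.1.le
        exact (hz r hra).mono (Ioi_subset_Ici hra)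
      · refine ContinuousOn.intervalIntegrable ?_
        rw [uIcc_of_le hle]
        exact hz'.mono (hI.trans hsub)
    · refine (hu1 r (hI hr) r' (hI hr') ?_).le
      refine lt_of_le_of_lt ?_ (hmi.trans_le (min_le_left _ _))
      rw [Real.dist_eq, abs_le]
      constructor <;> linarith [hr.1, hr.2, hr'.1, hr'.2]
    · refine (hu2 _ (hI (right_mem_Icc.2 hle)) _ hsm ?_).le
      rw [Real.dist_eq, abs_of_nonneg (sub_nonneg.2 hle)]
      exact hmi.trans_le (min_le_right _ _)
  · rw [Finset.sum_add_distrib, ← Finset.mul_sum, ← Finset.mul_sum, htel2]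
    linarith

/-! ### Absolute moments of Gaussian increments -/

/-- The absolute moments of the standard Gaussian. -/
noncomputable def gaussianAbsMoment (k : ℕ) : ℝ≥0∞ :=
  ∫⁻ x, ENNReal.ofReal (|x| ^ k) ∂(gaussianReal 0 1)

theorem gaussianAbsMoment_ne_top (k : ℕ) : gaussianAbsMoment k ≠ ∞ := by
  have h := ((memLp_id_gaussianReal (μ := 0) (v := 1) k).integrable_norm_pow' ).lintegral_lt_top
  exact h.ne

theorem lintegral_abs_pow_of_hasLaw {Ω : Type*} [MeasurableSpace Ω] {Q : Measure Ω} {X : Ω → ℝ}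
    {r : ℝ} (hr : 0 ≤ r) (h : HasLaw X (gaussianReal 0 r.toNNReal) Q) (k : ℕ) :
    ∫⁻ ω, ENNReal.ofReal (|X ω| ^ k) ∂Q = ENNReal.ofReal (√r ^ k) * gaussianAbsMoment k := by
  have h1 : gaussianReal 0 r.toNNReal = (gaussianReal 0 1).map (√r * ·) := by
    rw [gaussianReal_map_const_mul]
    congr 1
    · simp
    · ext
      simp [hr]
  rw [h.lintegral_comp (f := fun x => ENNReal.ofReal (|x| ^ k)) (by fun_prop), h1,
    lintegral_map (by fun_prop) (by fun_prop), gaussianAbsMoment, ← lintegral_const_mul _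
    (by fun_prop)]
  congr 1
  ext x
  rw [abs_mul, mul_pow, abs_of_nonneg (Real.sqrt_nonneg r), ENNReal.ofReal_mul (by positivity)]

/-- Convergence even holds in `L¹`: the third absolute moment of an increment is a constant times
`(Δt)^{3/2} ≤ √mesh · Δt`, and the `Δt` sum to `b - a`. -/
theorem tendstoInMeasure_cubic_variation {Ω : Type*} [MeasurableSpace Ω] {Q : Measure Ω}
    {W : ℝ → Ω → ℝ} (hm : ∀ t, Measurable (W t))
    (hlaw : ∀ s t : ℝ, s ≤ t →
      HasLaw (fun ω => W t ω - W s ω) (gaussianReal 0 (t - s).toNNReal) Q)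
    {a b : ℝ} {N : ℕ → ℕ} {p : ℕ → ℕ → ℝ}
    (hp : ∀ n, Monotone (p n) ∧ p n 0 = a ∧ p n (N n) = b)
    (hmesh : ∀ ε > 0, ∀ᶠ n in atTop, ∀ i < N n, p n (i + 1) - p n i < ε) :
    TendstoInMeasure Q
      (fun n ω => ∑ i ∈ Finset.range (N n), |W (p n (i + 1)) ω - W (p n i) ω| ^ 3) atTop
      (fun _ => 0) := by
  have hab : a ≤ b := by
    obtain ⟨h1, h2, h3⟩ := hp 0
    rw [← h2, ← h3]
    exact h1 (Nat.zero_le _)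
  have hmeas : ∀ n, Measurable
      (fun ω => ∑ i ∈ Finset.range (N n), |W (p n (i + 1)) ω - W (p n i) ω| ^ 3) := by
    intro n
    have := hm
    fun_prop
  refine tendstoInMeasure_of_tendsto_eLpNorm one_ne_zero (fun n => (hmeas n).aestronglyMeasurable)
    aestronglyMeasurable_const ?_
  have hnorm : ∀ n, eLpNorm ((fun ω => ∑ i ∈ Finset.range (N n),
      |W (p n (i + 1)) ω - W (p n i) ω| ^ 3) - fun _ => (0 : ℝ)) 1 Q =
      ∑ i ∈ Finset.range (N n), ENNReal.ofReal (√(p n (i + 1) - p n i) ^ 3) *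
        gaussianAbsMoment 3 := by
    intro n
    rw [eLpNorm_one_eq_lintegral_enorm]
    have e : ∀ ω, ‖(((fun ω => ∑ i ∈ Finset.range (N n),
        |W (p n (i + 1)) ω - W (p n i) ω| ^ 3) - fun _ => (0 : ℝ)) : Ω → ℝ) ω‖ₑ =
        ∑ i ∈ Finset.range (N n), ENNReal.ofReal (|W (p n (i + 1)) ω - W (p n i) ω| ^ 3) := by
      intro ω
      rw [Pi.sub_apply, sub_zero, Real.enorm_of_nonneg (by positivity),
        ENNReal.ofReal_sum_of_nonneg fun i _ => by positivity]
    simp_rw [e]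
    rw [lintegral_finsetSum _ fun i _ => by have := hm; fun_prop]
    refine Finset.sum_congr rfl fun i _ => ?_
    have hle := (hp n).1 (Nat.le_succ i)
    exact lintegral_abs_pow_of_hasLaw (sub_nonneg.2 hle) (hlaw _ _ hle) 3
  simp_rw [hnorm, ← Finset.sum_mul]
  have hC := gaussianAbsMoment_ne_top 3
  have hsum : Tendsto (fun n => ∑ i ∈ Finset.range (N n), √(p n (i + 1) - p n i) ^ 3)
      atTop (𝓝 0) := by
    rw [Metric.tendsto_nhds]
    intro ε hε
    have hpos : 0 < ε / (b - a + 1) := by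
      have := sub_nonneg.2 hab
      positivity
    filter_upwards [hmesh ((ε / (b - a + 1)) ^ 2) (by positivity)] with n hn
    obtain ⟨h1, h2, h3⟩ := hp n
    have hle : ∑ i ∈ Finset.range (N n), √(p n (i + 1) - p n i) ^ 3 ≤
        ∑ i ∈ Finset.range (N n), ε / (b - a + 1) * (p n (i + 1) - p n i) := by
      refine Finset.sum_le_sum fun i hi => ?_
      have h0 : 0 ≤ p n (i + 1) - p n i := sub_nonneg.2 (h1 (Nat.le_succ i))
      rw [pow_succ, Real.sq_sqrt h0, mul_comm]
      refine mul_le_mul_of_nonneg_right ?_ h0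
      exact Real.sqrt_le_iff.2 ⟨hpos.le, (hn i (Finset.mem_range.1 hi)).le⟩
    rw [← Finset.mul_sum, Finset.sum_range_sub, h2, h3] at hle
    rw [Real.dist_eq, sub_zero, abs_of_nonneg (Finset.sum_nonneg fun i _ => by positivity)]
    refine hle.trans_lt ?_
    have : 0 ≤ b - a := sub_nonneg.2 hab
    rw [div_mul_eq_mul_div, div_lt_iff₀ (by positivity)]
    nlinarith
  have h2 : Tendsto (fun n => ENNReal.ofReal (∑ i ∈ Finset.range (N n),
      √(p n (i + 1) - p n i) ^ 3) * gaussianAbsMoment 3) atTop (𝓝 0) := by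
    have := ENNReal.Tendsto.mul_const (b := gaussianAbsMoment 3)
      (ENNReal.tendsto_ofReal hsum) (Or.inr hC)
    simpa using this
  refine h2.congr fun n => ?_
  rw [ENNReal.ofReal_sum_of_nonneg fun i _ => by positivity]

/-! ### Bernoulli's formula solves the Stratonovich equation -/

section Generated

variable {δ lam : ℝ} {β : ℝ → ℝ}

theorem incrementSigma_le (τ t : ℝ) :
    incrementSigma δ τ t ≤ (inferInstance : MeasurableSpace (SamplePath δ)) :=
  iSup₂_le fun s _ =>
    ((SamplePath.measurable_eval s).sub (SamplePath.measurable_eval τ)).comap_le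

theorem bernoulliCocycle_continuousOn (hβ : Continuous β) (hpos : ∀ s, 0 < β s) (τ x₀ : ℝ)
    (ω : SamplePath δ) :
    ContinuousOn (fun t => bernoulliCocycle β lam (t - τ).toNNReal τ (ω.shift τ) x₀) (Ici τ) := by
  have h : ContinuousOn (fun t => Real.exp (-δ * ω.1 t) *
      bernoulliCocycle β lam (t - τ).toNNReal τ (ω.shift τ) x₀) (Ici τ) := fun t ht =>
    ((bernoulliCocycle_isPathwiseSolution hβ hpos τ x₀ ω).hasDeriv t ht).continuousWithinAt
  have hω := ω.continuous_coe
  have h2 : Continuous fun t => Real.exp (δ * ω.1 t) := by fun_prop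
  refine (h2.continuousOn.mul h).congr fun t _ => ?_
  rw [Pi.mul_apply, ← mul_assoc, ← Real.exp_add]
  simp

/-- Trapezoidal sums converge along each path whose cubic variation vanishes. This is known only in
probability, so the subsequence criterion is used: each subsequence has a further one along which
the cubic variation vanishes almost surely. -/
theorem bernoulliCocycle_hasStratonovichIntegral {Q : Measure (SamplePath δ)} [IsFiniteMeasure Q]
    (hlaw : ∀ s t : ℝ, s ≤ t → HasLaw (fun ω : SamplePath δ => ω.1 t - ω.1 s)
      (gaussianReal 0 (t - s).toNNReal) Q)
    (hβ : Continuous β) (hpos : ∀ s, 0 < β s) {τ t : ℝ} (ht : τ ≤ t) (x₀ : ℝ) :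
    HasStratonovichIntegral Q
      (fun s ω => δ * bernoulliCocycle β lam (s - τ).toNNReal τ (ω.shift τ) x₀) τ t
      (fun ω => bernoulliCocycle β lam (t - τ).toNNReal τ (ω.shift τ) x₀ - x₀ -
        ∫ s in τ..t, (lam * bernoulliCocycle β lam (s - τ).toNNReal τ (ω.shift τ) x₀ -
          β s * bernoulliCocycle β lam (s - τ).toNNReal τ (ω.shift τ) x₀ ^ 3)) := by
  intro N p hp hmesh
  set X : ℝ → SamplePath δ → ℝ :=
    fun s ω => bernoulliCocycle β lam (s - τ).toNNReal τ (ω.shift τ) x₀ with hX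
  have hXm : ∀ s ≥ τ, Measurable (X s) := fun s hs =>
    (bernoulliCocycle_adapted hβ hs x₀).mono (incrementSigma_le τ s) le_rfl
  -- The partitions are quantified again, because the claim is applied to subsequences of the given
  -- ones.
  have hpath : ∀ ω : SamplePath δ, ∀ (N : ℕ → ℕ) (p : ℕ → ℕ → ℝ),
      (∀ n, Monotone (p n) ∧ p n 0 = τ ∧ p n (N n) = t) →
      (∀ ε > 0, ∀ᶠ n in atTop, ∀ i < N n, p n (i + 1) - p n i < ε) →
      Tendsto (fun n => ∑ i ∈ Finset.range (N n), |ω.1 (p n (i + 1)) - ω.1 (p n i)| ^ 3)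
        atTop (𝓝 0) →
      Tendsto (fun n => ∑ i ∈ Finset.range (N n),
        (δ * X (p n i) ω + δ * X (p n (i + 1)) ω) / 2 * (ω.1 (p n (i + 1)) - ω.1 (p n i)))
        atTop (𝓝 (X t ω - x₀ - ∫ s in τ..t, (lam * X s ω - β s * X s ω ^ 3))) := by
    intro ω N p hp hmesh h3
    have hsol := bernoulliCocycle_isPathwiseSolution (lam := lam) hβ hpos τ x₀ ω
    have hXc := bernoulliCocycle_continuousOn (lam := lam) hβ hpos τ x₀ ω
    have hω := ω.continuous_coe
    have hcancel : ∀ s y, Real.exp (δ * ω.1 s) * (Real.exp (-δ * ω.1 s) * y) = y := by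
      intro s y
      rw [← mul_assoc, ← Real.exp_add]
      simp
    have hz'c : ContinuousOn (fun s => Real.exp (-δ * ω.1 s) *
        (lam * X s ω - β s * X s ω ^ 3)) (Ici τ) := by
      have h1 : Continuous fun s => Real.exp (-δ * ω.1 s) := by fun_prop
      exact h1.continuousOn.mul ((continuousOn_const.mul hXc).sub
        (hβ.continuousOn.mul (hXc.pow 3)))
    have := tendsto_trapezoidal_sum (δ := δ) ht hω hsol.hasDeriv hz'c hp hmesh h3
    simp only [hcancel, hsol.initial] at this
    exact this
  have hmem : ∀ n, ∀ i, τ ≤ p n i := fun n i => by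
    obtain ⟨h1, h2, -⟩ := hp n
    exact h2 ▸ h1 (Nat.zero_le i)
  refine (exists_seq_tendstoInMeasure_atTop_iff fun n => Measurable.aestronglyMeasurable ?_).2 ?_
  · refine Finset.measurable_fun_sum _ fun i _ => ?_
    exact ((((hXm _ (hmem n i)).const_mul δ).add ((hXm _ (hmem n (i + 1))).const_mul δ)).div_const
      2).mul ((SamplePath.measurable_eval _).sub (SamplePath.measurable_eval _))
  · intro ns hns
    have hcub := tendstoInMeasure_cubic_variation (Q := Q) (W := fun t (ω : SamplePath δ) => ω.1 t)
      (fun t => SamplePath.measurable_eval t) hlaw (a := τ) (b := t) (N := fun n => N (ns n))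
      (p := fun n => p (ns n)) (fun n => hp _)
      (fun ε hε => hns.tendsto_atTop.eventually (hmesh ε hε))
    obtain ⟨ns', hns', hae⟩ := hcub.exists_seq_tendsto_ae
    refine ⟨ns', hns', ?_⟩
    filter_upwards [hae] with ω hω
    exact hpath ω (fun n => N (ns (ns' n))) (fun n => p (ns (ns' n))) (fun n => hp _)
      (fun ε hε => (hns.comp hns').tendsto_atTop.eventually (hmesh ε hε)) hω

theorem bernoulliCocycle_isGeneratedCocycle {Q : Measure (SamplePath δ)} [IsFiniteMeasure Q]
    (hlaw : ∀ s t : ℝ, s ≤ t → HasLaw (fun ω : SamplePath δ => ω.1 t - ω.1 s)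
      (gaussianReal 0 (t - s).toNNReal) Q)
    (hβ : Continuous β) (hpos : ∀ s, 0 < β s) :
    IsGeneratedCocycle Q β lam (bernoulliCocycle β lam) where
  cocycle := bernoulliCocycle_isContinuousCocycle hβ hpos
  stratonovich τ x₀ :=
    { initial := fun ω => (bernoulliCocycle_isPathwiseSolution hβ hpos τ x₀ ω).initial
      continuous := fun ω => bernoulliCocycle_continuousOn hβ hpos τ x₀ ω
      adapted := fun _ ht => bernoulliCocycle_adapted hβ ht x₀
      integral_eq := fun _ ht => bernoulliCocycle_hasStratonovichIntegral hlaw hβ hpos ht x₀ }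
  pathwise τ x₀ ω := bernoulliCocycle_isPathwiseSolution hβ hpos τ x₀ ω

end Generated

/-! ### Dyadic chaining and sublinear growth -/

/-- Chaining: an odd point of level `k + 1` is one increment of that level away from its left
neighbour, a point of level `k`; even points already belong to level `k`. -/
theorem abs_dyadic_le {f : ℝ → ℝ} {L a ρ : ℝ} (ha : 0 ≤ a) (hρ : 0 ≤ ρ) (h0 : f 0 = 0)
    (h : ∀ k j : ℕ, j < 2 ^ k → |f (L * (j + 1) / 2 ^ k) - f (L * j / 2 ^ k)| ≤ a * ρ ^ k)
    (k : ℕ) : ∀ j : ℕ, j ≤ 2 ^ k → |f (L * j / 2 ^ k)| ≤ a * ∑ i ∈ Finset.range (k + 1), ρ ^ i := by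
  induction k with
  | zero =>
    intro j hj
    have h1 := h 0 0 (by norm_num)
    have hj' : j = 0 ∨ j = 1 := by
      rw [pow_zero] at hj
      omega
    rcases hj' with rfl | rfl
    · simp [h0, ha]
    · simpa [h0] using h1
  | succ k ih =>
    intro j hj
    have hp : ∀ m : ℕ, L * ((2 * m : ℕ) : ℝ) / 2 ^ (k + 1) = L * m / 2 ^ k := by
      intro m
      rw [pow_succ]
      push_cast
      field_simp
    rw [Finset.sum_range_succ, mul_add]
    have hlast : 0 ≤ a * ρ ^ (k + 1) := by positivity
    rcases Nat.even_or_odd' j with ⟨m, rfl | rfl⟩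
    · rw [hp]
      have := ih m (by rw [pow_succ] at hj; omega)
      linarith
    · have h1 := h (k + 1) (2 * m) (by omega)
      have h2 := ih m (by rw [pow_succ] at hj; omega)
      rw [hp] at h1
      have h3 : ((2 * m + 1 : ℕ) : ℝ) = ((2 * m : ℕ) : ℝ) + 1 := by push_cast; ring
      rw [h3]
      have h4 := abs_add_le (f (L * (((2 * m : ℕ) : ℝ) + 1) / 2 ^ (k + 1)) - f (L * m / 2 ^ k))
        (f (L * m / 2 ^ k))
      rw [sub_add_cancel] at h4
      linarith

/-- By continuity it suffices to bound `f` at the dyadic points below `t`, where the geometric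
series dominates the chaining sum. -/
theorem abs_le_of_dyadic_increments {f : ℝ → ℝ} {L a ρ : ℝ} (hf : Continuous f) (hL : 0 < L)
    (ha : 0 ≤ a) (hρ : 0 ≤ ρ) (hρ1 : ρ < 1) (h0 : f 0 = 0)
    (h : ∀ k j : ℕ, j < 2 ^ k → |f (L * (j + 1) / 2 ^ k) - f (L * j / 2 ^ k)| ≤ a * ρ ^ k)
    {t : ℝ} (ht : t ∈ Icc 0 L) : |f t| ≤ a * (1 - ρ)⁻¹ := by
  have htL : 0 ≤ t / L := div_nonneg ht.1 hL.le
  have hlim : Tendsto (fun k : ℕ => L * (⌊t / L * 2 ^ k⌋₊ : ℝ) / 2 ^ k) atTop (𝓝 t) := by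
    have h1 := (tendsto_nat_floor_mul_div_atTop (R := ℝ) htL).comp
      (tendsto_pow_atTop_atTop_of_one_lt (one_lt_two (α := ℝ)))
    have h2 := h1.const_mul L
    rw [mul_div_cancel₀ _ hL.ne'] at h2
    refine h2.congr fun k => ?_
    simp [mul_div_assoc]
  refine le_of_tendsto ((hf.tendsto t).comp hlim).abs (Eventually.of_forall fun k => ?_)
  have hj : ⌊t / L * 2 ^ k⌋₊ ≤ 2 ^ k := by
    refine Nat.floor_le_of_le ?_
    push_cast
    refine mul_le_of_le_one_left (by positivity) ?_
    rw [div_le_one hL]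
    exact ht.2
  refine (abs_dyadic_le ha hρ h0 h k _ hj).trans (mul_le_mul_of_nonneg_left ?_ ha)
  rw [← tsum_geometric_of_lt_one hρ hρ1]
  exact (summable_geometric_of_lt_one hρ hρ1).sum_le_tsum _ fun i _ => by positivity

section Chaining

variable {Ω : Type*} [MeasurableSpace Ω] {P : Measure Ω} {W : ℝ → Ω → ℝ} {C : ℝ≥0∞}

/-- Markov's inequality for the fourth power and a union bound: level `k` contributes `2^k ·
(L/2^k)² / (aρ^k)⁴`, up to the factor `C`. The series is useful when `2ρ⁴ > 1`. -/
theorem measure_exists_dyadic_increment_le (hm : ∀ t, Measurable (W t))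
    (hmom : ∀ s t : ℝ, 0 ≤ s → s ≤ t →
      ∫⁻ ω, ENNReal.ofReal (|W t ω - W s ω| ^ 4) ∂P ≤ ENNReal.ofReal ((t - s) ^ 2) * C)
    {L a ρ : ℝ} (hL : 0 < L) (ha : 0 < a) (hρ : 0 < ρ) :
    P {ω | ∃ k j : ℕ, j < 2 ^ k ∧
        a * ρ ^ k < |W (L * (j + 1) / 2 ^ k) ω - W (L * j / 2 ^ k) ω|} ≤
      ENNReal.ofReal (L ^ 2 / a ^ 4) * C * ∑' k : ℕ, ENNReal.ofReal ((1 / (2 * ρ ^ 4)) ^ k) := by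
  have hone : ∀ k j : ℕ, P {ω | a * ρ ^ k <
      |W (L * (j + 1) / 2 ^ k) ω - W (L * j / 2 ^ k) ω|} ≤
      ENNReal.ofReal (L ^ 2 / a ^ 4 * (1 / (4 * ρ ^ 4)) ^ k) * C := by
    intro k j
    set s := L * j / 2 ^ k
    set t := L * (j + 1) / 2 ^ k
    have hs : 0 ≤ s := by positivity
    have hts : t - s = L / 2 ^ k := by simp only [s, t]; ring
    have hst : s ≤ t := by
      have : 0 < L / 2 ^ k := by positivity
      linarith
    have hα : 0 < (a * ρ ^ k) ^ 4 := by positivity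
    have h1 : {ω | a * ρ ^ k < |W t ω - W s ω|} ⊆
        {ω | ENNReal.ofReal ((a * ρ ^ k) ^ 4) ≤ ENNReal.ofReal (|W t ω - W s ω| ^ 4)} :=
      fun ω hω => ENNReal.ofReal_le_ofReal (pow_le_pow_left₀ (by positivity) (le_of_lt hω) 4)
    refine (measure_mono h1).trans ((meas_ge_le_lintegral_div
      (by have := hm; fun_prop) (ENNReal.ofReal_pos.2 hα).ne' ENNReal.ofReal_ne_top).trans ?_)
    refine (ENNReal.div_le_div_right (hmom s t hs hst) _).trans_eq ?_
    rw [hts, ENNReal.mul_div_right_comm, ← ENNReal.ofReal_div_of_pos hα]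
    congr 2
    rw [one_div, inv_pow, mul_pow, mul_pow, div_pow, ← pow_mul, ← pow_mul, ← pow_mul,
      mul_comm k 2, mul_comm k 4, pow_mul 2 2 k]
    norm_num
    field_simp
  have hset : {ω | ∃ k j : ℕ, j < 2 ^ k ∧
      a * ρ ^ k < |W (L * (j + 1) / 2 ^ k) ω - W (L * j / 2 ^ k) ω|} =
      ⋃ k : ℕ, ⋃ j ∈ Finset.range (2 ^ k),
        {ω | a * ρ ^ k < |W (L * (j + 1) / 2 ^ k) ω - W (L * j / 2 ^ k) ω|} := by
    ext ω
    simp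
  rw [hset, ← ENNReal.tsum_mul_left]
  refine (measure_iUnion_le _).trans (ENNReal.tsum_le_tsum fun k => ?_)
  refine (measure_biUnion_finset_le _ _).trans ((Finset.sum_le_sum fun j _ => hone k j).trans ?_)
  rw [Finset.sum_const, Finset.card_range, nsmul_eq_mul, mul_right_comm, ← mul_assoc]
  refine mul_le_mul_left (le_of_eq ?_) _
  have e : ((2 ^ k : ℕ) : ℝ≥0∞) = ENNReal.ofReal (2 ^ k) := by
    rw [ENNReal.ofReal_pow (by norm_num)]
    simp
  rw [e, ← ENNReal.ofReal_mul (by positivity), ← ENNReal.ofReal_mul (by positivity)]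
  congr 1
  rw [mul_left_comm, ← mul_pow]
  congr 2
  field_simp
  norm_num

/-- A continuous process with `E |W_t - W_s|⁴ ≤ C (t - s)²` grows sublinearly. -/
theorem ae_tendsto_div_atTop_of_moment (hm : ∀ t, Measurable (W t))
    (hc : ∀ ω, Continuous (fun t => W t ω)) (h0 : ∀ ω, W 0 ω = 0) (hC : C ≠ ∞)
    (hmom : ∀ s t : ℝ, 0 ≤ s → s ≤ t →
      ∫⁻ ω, ENNReal.ofReal (|W t ω - W s ω| ^ 4) ∂P ≤ ENNReal.ofReal ((t - s) ^ 2) * C) :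
    ∀ᵐ ω ∂P, Tendsto (fun t => W t ω / t) atTop (𝓝 0) := by
  -- On `[0, n+1]` the threshold `a = (n+1)/(m+1)` gives `(n+1)²/a⁴ = (m+1)⁴/(n+1)²`, summable in
  -- `n`, so Borel–Cantelli applies. The value `ρ = 9/10` satisfies both `ρ < 1` and `2ρ⁴ > 1`.
  have hkey : ∀ m : ℕ, ∀ᵐ ω ∂P, ∀ᶠ n : ℕ in atTop, ∀ t ∈ Icc (0 : ℝ) (n + 1),
      |W t ω| ≤ 1 / (m + 1) * (n + 1) * (1 - 9 / 10)⁻¹ := by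
    intro m
    have hsum : ∑' n : ℕ, P {ω | ∃ k j : ℕ, j < 2 ^ k ∧ 1 / ((m : ℝ) + 1) * ((n : ℝ) + 1) *
        (9 / 10) ^ k < |W (((n : ℝ) + 1) * (j + 1) / 2 ^ k) ω -
          W (((n : ℝ) + 1) * j / 2 ^ k) ω|} ≠ ∞ := by
      refine ne_top_of_le_ne_top ?_ (ENNReal.tsum_le_tsum fun n =>
        measure_exists_dyadic_increment_le (C := C) hm hmom (L := (n : ℝ) + 1)
          (a := 1 / ((m : ℝ) + 1) * ((n : ℝ) + 1)) (ρ := 9 / 10) (by positivity) (by positivity)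
          (by norm_num))
      rw [ENNReal.tsum_mul_right, ENNReal.tsum_mul_right]
      refine ENNReal.mul_ne_top (ENNReal.mul_ne_top ?_ hC) ?_
      · refine Summable.tsum_ofReal_ne_top ?_
        have h1 : Summable fun n : ℕ => ((m : ℝ) + 1) ^ 4 * (1 / ((n + 1 : ℕ) : ℝ) ^ 2) :=
          (((summable_nat_add_iff 1).2
            (Real.summable_one_div_nat_pow (p := 2).2 one_lt_two))).mul_left _
        refine h1.congr fun n => ?_
        push_cast
        field_simp
      · exact (summable_geometric_of_lt_one (by norm_num) (by norm_num)).tsum_ofReal_ne_top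
    filter_upwards [ae_eventually_notMem hsum] with ω hω
    filter_upwards [hω] with n hn t ht
    simp only [not_exists, not_and, not_lt] at hn
    exact abs_le_of_dyadic_increments (hc ω) (by positivity) (by positivity) (by norm_num)
      (by norm_num) (h0 ω) hn ht
  filter_upwards [ae_all_iff.2 hkey] with ω hω
  rw [Metric.tendsto_atTop']
  intro ε hε
  -- The constant is `10 · 2`: the geometric series gives `(1 - 9/10)⁻¹ = 10`, and `⌊t⌋ + 1 ≤ 2t`
  -- costs the factor `2`.
  obtain ⟨m, hm'⟩ := exists_nat_gt (20 / ε)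
  obtain ⟨n₀, hn₀⟩ := eventually_atTop.1 (hω m)
  refine ⟨n₀ + 1, fun t ht => ?_⟩
  have hn₀' : (0 : ℝ) ≤ n₀ := Nat.cast_nonneg _
  have ht0 : 0 < t := by linarith
  have hfl : n₀ ≤ ⌊t⌋₊ := Nat.le_floor (by linarith)
  have h1 := hn₀ _ hfl t ⟨ht0.le, (Nat.lt_floor_add_one t).le⟩
  have h2 : (⌊t⌋₊ : ℝ) + 1 ≤ 2 * t := by
    have := Nat.floor_le ht0.le
    linarith
  rw [Real.dist_eq, sub_zero, abs_div, abs_of_pos ht0, div_lt_iff₀ ht0]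
  refine h1.trans_lt ?_
  have h3 : 20 < ε * (m + 1) := by
    rw [div_lt_iff₀ hε] at hm'
    nlinarith
  have h4 : 1 / ((m : ℝ) + 1) * (⌊t⌋₊ + 1) * (1 - 9 / 10)⁻¹ ≤ 20 * t / (m + 1) := by
    have : 1 / ((m : ℝ) + 1) * (⌊t⌋₊ + 1) * (1 - 9 / 10)⁻¹ = 10 * (⌊t⌋₊ + 1) / (m + 1) := by
      norm_num
      ring
    rw [this]
    exact div_le_div_of_nonneg_right (by linarith) (by positivity)
  refine h4.trans_lt ?_
  rw [div_lt_iff₀ (by positivity)]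
  nlinarith

end Chaining

/-! ### Divergence of the exponential functional of Brownian motion -/

/-- The piece over `[0, r)` is finite and the subtraction of `f r` only rescales. Divergence is thus
a tail event, determined by the increments after any time `r`. -/
theorem lintegral_exp_shift_eq_top_iff {c : ℝ} {f : ℝ → ℝ} (hf : Continuous f) {r : ℝ}
    (hr : 0 ≤ r) :
    (∫⁻ s in Ici (0 : ℝ), ENNReal.ofReal (Real.exp (c * (f (s + r) - f r)))) = ∞ ↔
      (∫⁻ s in Ici (0 : ℝ), ENNReal.ofReal (Real.exp (c * f s))) = ∞ := by
  have e1 : ∀ s, ENNReal.ofReal (Real.exp (c * (f (s + r) - f r))) =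
      ENNReal.ofReal (Real.exp (-(c * f r))) * ENNReal.ofReal (Real.exp (c * f (s + r))) := by
    intro s
    rw [← ENNReal.ofReal_mul (Real.exp_pos _).le, ← Real.exp_add]
    congr 2
    ring
  have e2 : (∫⁻ s in Ici (0 : ℝ), ENNReal.ofReal (Real.exp (c * f (s + r)))) =
      ∫⁻ s in Ici r, ENNReal.ofReal (Real.exp (c * f s)) := by
    rw [← (measurePreserving_add_right (volume : Measure ℝ) r).setLIntegral_comp_preimage_emb
      (measurableEmbedding_addRight r) (fun s => ENNReal.ofReal (Real.exp (c * f s))) (Ici r)]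
    congr 2
    ext s
    simp
  have e3 : (∫⁻ s in Ici (0 : ℝ), ENNReal.ofReal (Real.exp (c * f s))) =
      (∫⁻ s in Ico 0 r, ENNReal.ofReal (Real.exp (c * f s))) +
        ∫⁻ s in Ici r, ENNReal.ofReal (Real.exp (c * f s)) := by
    rw [← Ico_union_Ici_eq_Ici hr, lintegral_union measurableSet_Ici]
    exact disjoint_left.2 fun s hs hs' => absurd hs.2 (not_lt.2 hs')
  have hfin : (∫⁻ s in Ico 0 r, ENNReal.ofReal (Real.exp (c * f s))) ≠ ∞ := by
    have hc : Continuous fun s => Real.exp (c * f s) := by fun_prop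
    exact ((hc.continuousOn.integrableOn_compact (isCompact_Icc (a := 0) (b := r))).mono_set
      Ico_subset_Icc_self).lintegral_lt_top.ne
  simp_rw [e1]
  rw [lintegral_const_mul' _ _ ENNReal.ofReal_ne_top, e2, e3]
  have h0 := (ENNReal.ofReal_pos.2 (Real.exp_pos (-(c * f r)))).ne'
  rw [ENNReal.mul_eq_top, ENNReal.add_eq_top]
  simp [h0, hfin]

/-- By symmetry both closed half-lines have the same mass, and together they cover the line. The
degenerate case `v = 0` is included, as it occurs at time `0`. -/
theorem half_le_gaussianReal_Ici (v : ℝ≥0) : 1 / 2 ≤ gaussianReal 0 v (Ici 0) := by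
  have h1 : gaussianReal 0 v (Iic 0) = gaussianReal 0 v (Ici 0) := by
    conv_lhs => rw [show gaussianReal 0 v = (gaussianReal 0 v).map (fun x => -x) by
      rw [gaussianReal_map_neg, neg_zero]]
    rw [Measure.map_apply measurable_neg measurableSet_Iic]
    congr 1
    ext x
    simp
  have h2 : (1 : ℝ≥0∞) ≤ gaussianReal 0 v (Iic 0) + gaussianReal 0 v (Ici 0) := by
    rw [← measure_univ (μ := gaussianReal 0 v), ← Iic_union_Ici (a := (0 : ℝ))]
    exact measure_union_le _ _
  rw [h1, ← two_mul, mul_comm] at h2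
  exact ENNReal.div_le_of_le_mul h2

section Brownian

variable {Ω : Type*} [mΩ : MeasurableSpace Ω] {P : Measure Ω} {W : ℝ → Ω → ℝ}

/-- Kolmogorov's argument: the event is independent of the past up to each integer `n`, hence of the
`σ`-algebra generated by all these pasts. It belongs to that `σ`-algebra, so it is independent of
itself. -/
theorem measure_lintegral_exp_eq_top_eq_zero_or_one [IsProbabilityMeasure P]
    (hm : ∀ t, Measurable (W t)) (hc : ∀ ω, Continuous (fun t => W t ω))
    (hW : IsPreBrownianReal (fun (t : ℝ≥0) ω => W t ω) P) (c : ℝ) :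
    P {ω | (∫⁻ s in Ici (0 : ℝ), ENNReal.ofReal (Real.exp (c * W s ω))) = ∞} = 0 ∨
      P {ω | (∫⁻ s in Ici (0 : ℝ), ENNReal.ofReal (Real.exp (c * W s ω))) = ∞} = 1 := by
  set E := {ω | (∫⁻ s in Ici (0 : ℝ), ENNReal.ofReal (Real.exp (c * W s ω))) = ∞} with hE
  -- The `σ`-algebra is a variable: the claim serves for the ambient one, for the increments after
  -- time `n` and for the union of the pasts.
  have hmeas : ∀ (m : MeasurableSpace Ω) (V : ℝ → Ω → ℝ), (∀ ω, Continuous fun s => V s ω) →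
      (∀ s ≥ 0, Measurable[m] (V s)) →
      MeasurableSet[m] {ω | (∫⁻ s in Ici (0 : ℝ), ENNReal.ofReal (Real.exp (c * V s ω))) = ∞} := by
    intro m V hV hVm
    have h1 := @measurable_lintegral_of_continuous Ω m (fun s ω => Real.exp (c * V (max s 0) ω))
      (fun ω => by
        have := hV ω
        fun_prop)
      (fun s => ((hVm _ (le_max_right s 0)).const_mul c).exp) (volume.restrict (Ici 0)) _
    have h2 : ∀ ω, (∫⁻ s in Ici (0 : ℝ), ENNReal.ofReal (Real.exp (c * V s ω))) =
        ∫⁻ s in Ici (0 : ℝ), ENNReal.ofReal (Real.exp (c * V (max s 0) ω)) := fun ω =>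
      setLIntegral_congr_fun measurableSet_Ici fun s hs => by simp only [max_eq_left (mem_Ici.1 hs)]
    simp_rw [h2]
    exact h1 (measurableSet_singleton ∞)
  let past : ℕ → MeasurableSpace Ω := fun n =>
    MeasurableSpace.comap (fun ω (t : Iic (n : ℝ≥0)) => W (t : ℝ≥0) ω) inferInstance
  have hpast : ∀ (n : ℕ) (t : ℝ≥0), t ≤ n → Measurable[past n] (W t) := fun n t ht =>
    (measurable_pi_apply (X := fun _ : Iic (n : ℝ≥0) => ℝ) ⟨t, ht⟩).comp
      (comap_measurable fun ω (t : Iic (n : ℝ≥0)) => W (t : ℝ≥0) ω)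
  have hle : ∀ n, past n ≤ mΩ := fun n =>
    (measurable_pi_lambda _ fun t => hm _).comap_le
  have hEm : MeasurableSet E := hmeas mΩ W hc fun s _ => hm s
  have hind : ∀ n, Indep (past n) (MeasurableSpace.generateFrom {E}) P := by
    intro n
    have h1 := (IndepFun_iff_Indep _ _ _).1 (hW.indepFun_shift (n : ℝ≥0))
    refine (indep_of_indep_of_le_left h1 (MeasurableSpace.generateFrom_singleton_le ?_)).symm
    have h2 : E = {ω | (∫⁻ s in Ici (0 : ℝ), ENNReal.ofReal (Real.exp
        (c * (W (s + n) ω - W n ω)))) = ∞} := by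
      ext ω
      exact (lintegral_exp_shift_eq_top_iff (hc ω) (Nat.cast_nonneg n)).symm
    rw [h2]
    refine hmeas _ (fun s ω => W (s + n) ω - W n ω) (fun ω => ?_) (fun s hs => ?_)
    · have := hc ω
      fun_prop
    · have h3 : (fun ω => W (s + n) ω - W n ω) =
          (fun x : ℝ≥0 → ℝ => x s.toNNReal) ∘
            (fun ω (t : ℝ≥0) => W ((n : ℝ≥0) + t : ℝ≥0) ω - W (n : ℝ≥0) ω) := by
        ext ω
        simp [Real.coe_toNNReal _ hs, add_comm]
      rw [h3]
      exact (measurable_pi_apply _).comp (comap_measurable _)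
  have hmono : Monotone past := by
    refine monotone_nat_of_le_succ fun n => ?_
    have h : Measurable[past (n + 1)] (fun ω (t : Iic (n : ℝ≥0)) => W (t : ℝ≥0) ω) :=
      @measurable_pi_lambda _ _ _ (past (n + 1)) _ _ fun t => hpast (n + 1) t
        (t.2.trans (by exact_mod_cast n.le_succ))
    exact h.comap_le
  have hsup := indep_iSup_of_monotone hind hle
    (MeasurableSpace.generateFrom_singleton_le hEm) hmono
  refine measure_eq_zero_or_one_of_indepSet_self
    (indep_of_indep_of_le_left hsup (MeasurableSpace.generateFrom_singleton_le ?_))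
  refine hmeas _ W hc fun s hs => ?_
  obtain ⟨n, hn⟩ := exists_nat_ge s
  have := hpast n s.toNNReal (by
    rw [Real.toNNReal_le_iff_le_coe]
    exact_mod_cast hn)
  rw [Real.coe_toNNReal _ hs] at this
  exact this.mono (le_iSup past n) le_rfl

/-- The functional dominates the time spent in `[0, ∞)`, whose mean up to time `n` is at least
`n/2`. Were the functional finite almost surely, that time divided by `n` would tend to `0`
boundedly, contradicting these means. The zero-one law does the rest. -/
theorem ae_lintegral_exp_eq_top [IsProbabilityMeasure P]
    (hm : ∀ t, Measurable (W t)) (hc : ∀ ω, Continuous (fun t => W t ω))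
    (hW : IsPreBrownianReal (fun (t : ℝ≥0) ω => W t ω) P) {c : ℝ} (hc0 : 0 ≤ c) :
    ∀ᵐ ω ∂P, (∫⁻ s in Ici (0 : ℝ), ENNReal.ofReal (Real.exp (c * W s ω))) = ∞ := by
  have hWm : Measurable (Function.uncurry W) :=
    measurable_uncurry_of_continuous_of_measurable hc hm
  have hGm := measurable_lintegral_of_continuous (f := fun s ω => Real.exp (c * W s ω))
    (fun ω => by
      have := hc ω
      fun_prop) (fun s => by
      have := hm s
      fun_prop) (volume.restrict (Ici 0))
  set E := {ω | (∫⁻ s in Ici (0 : ℝ), ENNReal.ofReal (Real.exp (c * W s ω))) = ∞} with hE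
  have hEm : MeasurableSet E := hGm (measurableSet_singleton ∞)
  rcases measure_lintegral_exp_eq_top_eq_zero_or_one hm hc hW c with h0 | h1
  swap
  · exact (prob_compl_eq_zero_iff hEm).2 h1
  exfalso
  have hae : ∀ᵐ ω ∂P, (∫⁻ s in Ici (0 : ℝ), ENNReal.ofReal (Real.exp (c * W s ω))) ≠ ∞ :=
    measure_eq_zero_iff_ae_notMem.1 h0
  let J : ℕ → Ω → ℝ≥0∞ := fun n ω => ∫⁻ s in Icc (0 : ℝ) n, (Ici (0 : ℝ)).indicator 1 (W s ω)
  have hind : Measurable ((Ici (0 : ℝ)).indicator (1 : ℝ → ℝ≥0∞)) :=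
    measurable_one.indicator measurableSet_Ici
  have hJm : ∀ n, Measurable (J n) := fun n =>
    (hind.comp (hWm.comp measurable_swap)).lintegral_prod_right'
  have hJle : ∀ n ω, J n ω ≤ n := by
    intro n ω
    have : J n ω ≤ ∫⁻ _ in Icc (0 : ℝ) n, (1 : ℝ≥0∞) :=
      lintegral_mono fun s => indicator_le_self' (fun _ _ => zero_le) (W s ω)
    simpa using this
  have hJG : ∀ n ω, J n ω ≤ ∫⁻ s in Ici (0 : ℝ), ENNReal.ofReal (Real.exp (c * W s ω)) := by
    intro n ω
    refine (lintegral_mono_set Icc_subset_Ici_self).trans (lintegral_mono fun s => ?_)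
    by_cases hs : 0 ≤ W s ω
    · rw [indicator_of_mem (mem_Ici.2 hs), Pi.one_apply, ← ENNReal.ofReal_one]
      exact ENNReal.ofReal_le_ofReal (Real.one_le_exp (mul_nonneg hc0 hs))
    · rw [indicator_of_notMem (by simpa using hs)]
      exact zero_le
  have hEJ : ∀ n : ℕ, (n : ℝ≥0∞) / 2 ≤ ∫⁻ ω, J n ω ∂P := by
    intro n
    have hs : ∀ s ∈ Icc (0 : ℝ) n, 1 / 2 ≤ ∫⁻ ω, (Ici (0 : ℝ)).indicator 1 (W s ω) ∂P := by
      intro s hs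
      have hl := hW.hasLaw_eval s.toNNReal
      simp only [Real.coe_toNNReal _ hs.1] at hl
      rw [hl.lintegral_comp hind.aemeasurable, lintegral_indicator_one measurableSet_Ici]
      exact half_le_gaussianReal_Ici _
    have hjoint : Measurable (Function.uncurry fun ω s => (Ici (0 : ℝ)).indicator
        (1 : ℝ → ℝ≥0∞) (W s ω)) := hind.comp (hWm.comp measurable_swap)
    rw [lintegral_lintegral_swap hjoint.aemeasurable]
    calc (n : ℝ≥0∞) / 2 = ∫⁻ _ in Icc (0 : ℝ) n, (1 / 2 : ℝ≥0∞) := by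
          simp [div_eq_mul_inv, mul_comm]
      _ ≤ _ := setLIntegral_mono' measurableSet_Icc hs
  have hlim := tendsto_lintegral_of_dominated_convergence (μ := P) (F := fun n ω => J n ω / n)
    (f := fun _ => 0) (fun _ => 1) (fun n => (hJm n).div_const _)
    (fun n => ae_of_all _ fun ω => ENNReal.div_le_of_le_mul (by simpa using hJle n ω))
    (by simp) (by
      filter_upwards [hae] with ω hω
      refine tendsto_of_tendsto_of_tendsto_of_le_of_le tendsto_const_nhds ?_
        (fun _ => zero_le) (fun n => ENNReal.div_le_div_right (hJG n ω) _)
      simpa [div_eq_mul_inv] using ENNReal.Tendsto.const_mul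
        ENNReal.tendsto_inv_nat_nhds_zero (Or.inr hω))
  rw [lintegral_zero] at hlim
  have hge : ∀ᶠ n : ℕ in atTop, (1 / 2 : ℝ≥0∞) ≤ ∫⁻ ω, J n ω / n ∂P := by
    filter_upwards [eventually_gt_atTop 0] with n hn
    simp_rw [div_eq_mul_inv]
    rw [lintegral_mul_const _ (hJm n), ← div_eq_mul_inv, ← div_eq_mul_inv,
      ENNReal.le_div_iff_mul_le (Or.inl (by simpa using hn.ne'))
      (Or.inl (ENNReal.natCast_ne_top n))]
    refine le_trans (le_of_eq ?_) (hEJ n)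
    rw [ENNReal.div_eq_inv_mul, ENNReal.div_eq_inv_mul, mul_one]
  have := ge_of_tendsto hlim hge
  simp at this

end Brownian

/-! ### The regular paths carry the Wiener measure -/

theorem tendsto_div_atBot_iff (f : ℝ → ℝ) :
    Tendsto (fun t => f t / t) atBot (𝓝 0) ↔ Tendsto (fun t => f (-t) / t) atTop (𝓝 0) := by
  constructor
  · intro h
    have h1 := (h.comp tendsto_neg_atTop_atBot).neg
    simpa [Function.comp_def, div_neg] using h1
  · intro h
    have h1 := (h.comp tendsto_neg_atBot_atTop).neg
    simpa [Function.comp_def, div_neg] using h1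

theorem lintegral_Iic_zero_eq (f : ℝ → ℝ≥0∞) :
    ∫⁻ s in Iic (0 : ℝ), f s = ∫⁻ s in Ici (0 : ℝ), f (-s) := by
  rw [← (Measure.measurePreserving_neg (volume : Measure ℝ)).setLIntegral_comp_preimage_emb
    (MeasurableEquiv.neg ℝ).measurableEmbedding f (Iic 0)]
  congr 2
  ext s
  simp

/-- By continuity of paths the bounds defining the limit need only be tested at rational times: the
set of times violating one is open. -/
theorem measurableSet_tendsto_div_atTop {Ω : Type*} [MeasurableSpace Ω] {W : ℝ → Ω → ℝ}
    (hm : ∀ t, Measurable (W t)) (hc : ∀ ω, Continuous (fun t => W t ω)) :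
    MeasurableSet {ω | Tendsto (fun t => W t ω / t) atTop (𝓝 0)} := by
  have h : {ω | Tendsto (fun t => W t ω / t) atTop (𝓝 0)} =
      ⋂ k : ℕ, ⋃ N : ℕ, ⋂ q : ℚ,
        {ω | (N : ℝ) < q → |W q ω| ≤ 1 / ((k : ℝ) + 1) * q} := by
    ext ω
    simp only [mem_iInter, mem_iUnion]
    constructor
    · intro (h : Tendsto (fun t => W t ω / t) atTop (𝓝 0)) k
      obtain ⟨A, hA⟩ := (Metric.tendsto_atTop'.1 h) (1 / ((k : ℝ) + 1)) (by positivity)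
      obtain ⟨N, hN⟩ := exists_nat_gt A
      refine ⟨N, fun q hq => ?_⟩
      have hq0 : (0 : ℝ) < q := (Nat.cast_nonneg N).trans_lt hq
      have := hA q (hN.trans hq)
      rw [Real.dist_eq, sub_zero, abs_div, abs_of_pos hq0, div_lt_iff₀ hq0] at this
      exact this.le
    · intro h
      refine Metric.tendsto_atTop'.2 fun ε hε => ?_
      obtain ⟨k, hk⟩ := exists_nat_one_div_lt hε
      obtain ⟨N, hN⟩ := h k
      refine ⟨N, fun t ht => ?_⟩
      have ht0 : 0 < t := (Nat.cast_nonneg N).trans_lt ht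
      have key : |W t ω| ≤ 1 / ((k : ℝ) + 1) * t := by
        by_contra! hcon
        have hω := hc ω
        have hopen : IsOpen {s | (N : ℝ) < s ∧ 1 / ((k : ℝ) + 1) * s < |W s ω|} :=
          (isOpen_lt continuous_const continuous_id).inter
            (isOpen_lt (continuous_const.mul continuous_id) hω.abs)
        obtain ⟨q, hq⟩ :=
          (Rat.denseRange_cast (𝕜 := ℝ)).exists_mem_open hopen ⟨t, ht, hcon⟩
        exact absurd (hN q hq.1) (not_le.2 hq.2)
      rw [Real.dist_eq, sub_zero, abs_div, abs_of_pos ht0, div_lt_iff₀ ht0]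
      exact key.trans_lt (mul_lt_mul_of_pos_right hk ht0)
  rw [h]
  refine MeasurableSet.iInter fun k => MeasurableSet.iUnion fun N => MeasurableSet.iInter fun q => ?_
  by_cases hq : (N : ℝ) < q
  · simp only [hq, forall_const]
    exact measurableSet_le (by have := hm q; fun_prop) measurable_const
  · simp [hq]

theorem regularPaths_eq (δ : ℝ) : regularPaths δ =
    ({ω | Tendsto (fun t : ℝ => ω t / t) atTop (𝓝 0)} ∩
      {ω | Tendsto (fun t : ℝ => ω (-t) / t) atTop (𝓝 0)}) ∩
    ({ω | (∫⁻ s in Ici (0 : ℝ), ENNReal.ofReal (Real.exp (2 * δ * ω (-s)))) = ∞} ∩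
      {ω | (∫⁻ s in Ici (0 : ℝ), ENNReal.ofReal (Real.exp (2 * δ * ω s))) = ∞}) := by
  ext ω
  change (_ ∧ _ ∧ _ ∧ _) ↔ ((_ ∧ _) ∧ (_ ∧ _))
  rw [tendsto_div_atBot_iff (fun t => ω t),
    lintegral_Iic_zero_eq (fun s => ENNReal.ofReal (Real.exp (2 * δ * ω s))), and_assoc]
  exact Iff.rfl

theorem measurableSet_regularPaths (δ : ℝ) : MeasurableSet (regularPaths δ) := by
  have hc : ∀ ω : WienerSpace, Continuous fun t => ω t := WienerSpace.continuous_coe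
  have hm := WienerSpace.measurable_eval
  rw [regularPaths_eq]
  refine ((measurableSet_tendsto_div_atTop (W := fun t (ω : WienerSpace) => ω t) hm hc).inter
    (measurableSet_tendsto_div_atTop (W := fun t (ω : WienerSpace) => ω (-t)) (fun t => hm _)
      (fun ω => (hc ω).comp continuous_neg))).inter (MeasurableSet.inter ?_ ?_)
  · exact measurable_lintegral_of_continuous
      (f := fun s (ω : WienerSpace) => Real.exp (2 * δ * ω (-s)))
      (fun ω => by have := hc ω; fun_prop) (fun s => by have := hm (-s); fun_prop)
      (volume.restrict (Ici 0)) (measurableSet_singleton ∞)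
  · exact measurable_lintegral_of_continuous
      (f := fun s (ω : WienerSpace) => Real.exp (2 * δ * ω s))
      (fun ω => by have := hc ω; fun_prop) (fun s => by have := hm s; fun_prop)
      (volume.restrict (Ici 0)) (measurableSet_singleton ∞)

section Wiener

variable {P : Measure WienerSpace}

theorem IsWienerMeasure.isPreBrownianReal (hP : IsWienerMeasure P) :
    IsPreBrownianReal (fun (t : ℝ≥0) (ω : WienerSpace) => ω (t : ℝ)) P := by
  refine HasIndepIncrements.isPreBrownianReal_of_hasLaw (fun t => ?_) (fun n t ht => ?_)
  · have h := hP.hasLaw_increment 0 t t.2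
    have e : ∀ ω : WienerSpace, ω 0 = 0 := fun ω => ω.2
    simpa [e] using h
  · exact hP.hasIndepIncrements n (fun i => (t i : ℝ)) (NNReal.coe_mono.comp ht)

theorem IsWienerMeasure.isPreBrownianReal_neg (hP : IsWienerMeasure P) :
    IsPreBrownianReal (fun (t : ℝ≥0) (ω : WienerSpace) => ω (-(t : ℝ))) P := by
  refine HasIndepIncrements.isPreBrownianReal_of_hasLaw (fun t => ?_) (fun n t ht => ?_)
  · have h := gaussianReal_neg (hP.hasLaw_increment (-t) 0 (neg_nonpos.2 t.2))
    have e : ∀ ω : WienerSpace, ω 0 = 0 := fun ω => ω.2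
    simpa [e, Pi.neg_def] using h
  -- Negation reverses the order of the times, so the independent increments are reindexed by
  -- `Fin.rev` and change sign.
  · have h := hP.hasIndepIncrements n (fun i => -(t (Fin.rev i) : ℝ)) (fun i j hij =>
      neg_le_neg (NNReal.coe_le_coe.2 (ht (Fin.rev_le_rev.2 hij))))
    have h2 := (h.precomp (g := Fin.rev) Fin.rev_injective).comp (fun _ x => -x)
      (fun _ => measurable_neg)
    convert h2 using 2 with i
    ext ω
    simp [Fin.rev_succ, Fin.rev_castSucc]

theorem lintegral_increment_pow_four_le {Ω : Type*} [MeasurableSpace Ω] {Q : Measure Ω}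
    {W : ℝ → Ω → ℝ} (hW : IsPreBrownianReal (fun (t : ℝ≥0) ω => W t ω) Q) {s t : ℝ} (hs : 0 ≤ s)
    (hst : s ≤ t) : ∫⁻ ω, ENNReal.ofReal (|W t ω - W s ω| ^ 4) ∂Q ≤
      ENNReal.ofReal ((t - s) ^ 2) * gaussianAbsMoment 4 := by
  have h := hW.hasLaw_sub t.toNNReal s.toNNReal
  have e : nndist t.toNNReal.1 s.toNNReal.1 = (t - s).toNNReal := by
    ext
    rw [coe_nndist, Real.dist_eq]
    simp only [NNReal.val_eq_coe]
    rw [Real.coe_toNNReal _ (hs.trans hst), Real.coe_toNNReal _ hs,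
      abs_of_nonneg (sub_nonneg.2 hst), Real.coe_toNNReal _ (sub_nonneg.2 hst)]
  rw [e] at h
  have h2 := lintegral_abs_pow_of_hasLaw (sub_nonneg.2 hst) h 4
  simp only [Pi.sub_apply, Real.coe_toNNReal _ (hs.trans hst), Real.coe_toNNReal _ hs] at h2
  rw [h2, show (4 : ℕ) = 2 * 2 from rfl, pow_mul, Real.sq_sqrt (sub_nonneg.2 hst)]

theorem IsWienerMeasure.ae_mem_regularPaths (hP : IsWienerMeasure P) {δ : ℝ} (hδ : 0 ≤ δ) :
    ∀ᵐ ω ∂P, ω ∈ regularPaths δ := by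
  have hprob := hP.isProbabilityMeasure
  have hc : ∀ ω : WienerSpace, Continuous fun t => ω t := WienerSpace.continuous_coe
  have hc' : ∀ ω : WienerSpace, Continuous fun t => ω (-t) := fun ω =>
    (hc ω).comp continuous_neg
  have hm := WienerSpace.measurable_eval
  have e : ∀ ω : WienerSpace, ω 0 = 0 := fun ω => ω.2
  have h1 : ∀ᵐ ω ∂P, Tendsto (fun t : ℝ => ω t / t) atTop (𝓝 0) :=
    ae_tendsto_div_atTop_of_moment (W := fun t (ω : WienerSpace) => ω t) hm hc e
      (gaussianAbsMoment_ne_top 4)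
      (fun s t hs hst => lintegral_increment_pow_four_le
        (W := fun t (ω : WienerSpace) => ω t) hP.isPreBrownianReal hs hst)
  have h2 : ∀ᵐ ω ∂P, Tendsto (fun t : ℝ => ω (-t) / t) atTop (𝓝 0) :=
    ae_tendsto_div_atTop_of_moment (W := fun t (ω : WienerSpace) => ω (-t)) (fun t => hm _) hc'
      (fun ω => by rw [neg_zero, e]) (gaussianAbsMoment_ne_top 4)
      (fun s t hs hst => lintegral_increment_pow_four_le
        (W := fun t (ω : WienerSpace) => ω (-t)) hP.isPreBrownianReal_neg hs hst)
  have hδ' : 0 ≤ 2 * δ := by positivity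
  have h3 : ∀ᵐ ω ∂P, (∫⁻ s in Ici (0 : ℝ), ENNReal.ofReal (Real.exp (2 * δ * ω s))) = ∞ :=
    ae_lintegral_exp_eq_top (W := fun t (ω : WienerSpace) => ω t) hm hc hP.isPreBrownianReal hδ'
  have h4 : ∀ᵐ ω ∂P, (∫⁻ s in Ici (0 : ℝ), ENNReal.ofReal (Real.exp (2 * δ * ω (-s)))) = ∞ :=
    ae_lintegral_exp_eq_top (W := fun t (ω : WienerSpace) => ω (-t)) (fun t => hm _) hc'
      hP.isPreBrownianReal_neg hδ'
  filter_upwards [h1, h2, h3, h4] with ω a1 a2 a3 a4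
  rw [regularPaths_eq]
  exact ⟨⟨a1, a2⟩, a4, a3⟩

theorem IsWienerMeasure.measure_regularPaths (hP : IsWienerMeasure P) {δ : ℝ} (hδ : 0 ≤ δ) :
    P (regularPaths δ) = 1 := by
  have := hP.isProbabilityMeasure
  rw [← prob_compl_eq_zero_iff (measurableSet_regularPaths δ)]
  exact hP.ae_mem_regularPaths hδ

theorem IsWienerMeasure.map_sampleMeasure (hP : IsWienerMeasure P) {δ : ℝ} (hδ : 0 ≤ δ) :
    (sampleMeasure P δ).map Subtype.val = P := by
  rw [sampleMeasure, (MeasurableEmbedding.subtype_coe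
    (measurableSet_regularPaths δ)).map_comap, Subtype.range_coe_subtype]
  exact Measure.restrict_eq_self_of_ae_mem (hP.ae_mem_regularPaths hδ)

theorem IsWienerMeasure.isProbabilityMeasure_sampleMeasure (hP : IsWienerMeasure P) {δ : ℝ}
    (hδ : 0 ≤ δ) : IsProbabilityMeasure (sampleMeasure P δ) := by
  have := hP.isProbabilityMeasure
  constructor
  rw [← preimage_univ (f := (Subtype.val : SamplePath δ → WienerSpace)),
    ← Measure.map_apply measurable_subtype_coe MeasurableSet.univ, hP.map_sampleMeasure hδ,
    measure_univ]

theorem IsWienerMeasure.hasLaw_sampleMeasure (hP : IsWienerMeasure P) {δ : ℝ} (hδ : 0 ≤ δ)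
    {s t : ℝ} (hst : s ≤ t) : HasLaw (fun ω : SamplePath δ => ω.1 t - ω.1 s)
      (gaussianReal 0 (t - s).toNNReal) (sampleMeasure P δ) :=
  (hP.hasLaw_increment s t hst).comp
    ⟨measurable_subtype_coe.aemeasurable, hP.map_sampleMeasure hδ⟩

end Wiener

/-! ### The saturation function `y / √(1 + 2 y² K)` -/

section Saturation

variable {K x y : ℝ}

theorem monotone_div_sqrt (hK : 0 ≤ K) : Monotone fun x : ℝ => x / √(1 + 2 * x ^ 2 * K) := by
  have key : ∀ x y : ℝ, 0 ≤ x → x ≤ y →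
      x / √(1 + 2 * x ^ 2 * K) ≤ y / √(1 + 2 * y ^ 2 * K) := by
    intro x y hx hxy
    have hy := hx.trans hxy
    have h1 : 0 < 1 + 2 * x ^ 2 * K := by positivity
    have h2 : 0 < 1 + 2 * y ^ 2 * K := by positivity
    rw [div_le_div_iff₀ (Real.sqrt_pos.2 h1) (Real.sqrt_pos.2 h2)]
    refine abs_le_of_sq_le_sq' ?_ (by positivity) |>.2
    rw [mul_pow, mul_pow, Real.sq_sqrt h1.le, Real.sq_sqrt h2.le]
    nlinarith [pow_le_pow_left₀ hx hxy 2]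
  intro x y hxy
  change x / √(1 + 2 * x ^ 2 * K) ≤ y / √(1 + 2 * y ^ 2 * K)
  rcases le_total 0 x with hx | hx
  · exact key x y hx hxy
  · rcases le_total 0 y with hy | hy
    · exact (div_nonpos_of_nonpos_of_nonneg hx (Real.sqrt_nonneg _)).trans
        (div_nonneg hy (Real.sqrt_nonneg _))
    · have := key (-y) (-x) (neg_nonneg.2 hy) (neg_le_neg hxy)
      rw [neg_sq, neg_sq, neg_div, neg_div] at this
      linarith

theorem abs_div_sqrt_le_abs (hK : 0 ≤ K) (y : ℝ) : |y / √(1 + 2 * y ^ 2 * K)| ≤ |y| := by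
  rw [abs_div, abs_of_nonneg (Real.sqrt_nonneg _)]
  refine div_le_self (abs_nonneg _) ?_
  rw [Real.one_le_sqrt]
  have : 0 ≤ 2 * y ^ 2 * K := by positivity
  linarith

/-- The bound is the limit as `y → ∞`. Being free of `y`, it makes all pullback estimates uniform in
the initial state. -/
theorem abs_div_sqrt_le (hK : 0 < K) (y : ℝ) :
    |y / √(1 + 2 * y ^ 2 * K)| ≤ 1 / √(2 * K) := by
  have h1 : 0 < 1 + 2 * y ^ 2 * K := by positivity
  rw [abs_div, abs_of_nonneg (Real.sqrt_nonneg _),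
    div_le_div_iff₀ (Real.sqrt_pos.2 h1) (Real.sqrt_pos.2 (by positivity)), one_mul]
  refine abs_le_of_sq_le_sq' ?_ (by positivity) |>.2
  rw [mul_pow, Real.sq_sqrt h1.le, Real.sq_sqrt (by positivity), sq_abs]
  linarith

theorem div_sqrt_eq (hy : 0 < y) :
    y / √(1 + 2 * y ^ 2 * K) = 1 / √((y ^ 2)⁻¹ + 2 * K) := by
  have h : 1 + 2 * y ^ 2 * K = y ^ 2 * ((y ^ 2)⁻¹ + 2 * K) := by
    field_simp
  rw [h, Real.sqrt_mul (by positivity), Real.sqrt_sq hy.le]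
  field_simp

end Saturation

/-! ### Pullback representation -/

/-- The mass of Bernoulli's weight on the past. -/
noncomputable def pastMass {δ : ℝ} (β : ℝ → ℝ) (lam τ : ℝ) (ω : SamplePath δ) : ℝ :=
  ∫ r in Iic (0 : ℝ), bernoulliWeight δ lam (fun s => β (τ + s)) (fun s => ω.1 s) r

/-- The positive random equilibrium. -/
noncomputable def positiveEquilibrium {δ : ℝ} (β : ℝ → ℝ) (lam τ : ℝ) (ω : SamplePath δ) : ℝ :=
  1 / √(2 * pastMass β lam τ ω)

/-- The mass of Bernoulli's weight on `[-t, 0]`. -/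
noncomputable def recentMass {δ : ℝ} (β : ℝ → ℝ) (lam τ : ℝ) (ω : SamplePath δ) (t : ℝ) : ℝ :=
  ∫ r in (-t)..0, bernoulliWeight δ lam (fun s => β (τ + s)) (fun s => ω.1 s) r

section Pullback

variable {δ lam : ℝ} {β : ℝ → ℝ}

theorem continuous_sampleWeight (hβ : Continuous β) (lam τ : ℝ) (ω : SamplePath δ) :
    Continuous (bernoulliWeight δ lam (fun s => β (τ + s)) (fun s => ω.1 s)) :=
  continuous_bernoulliWeight (by fun_prop) ω.continuous_coe

theorem recentMass_nonneg (hpos : ∀ s, 0 < β s) {t : ℝ} (ht : 0 ≤ t) (τ : ℝ) (ω : SamplePath δ) :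
    0 ≤ recentMass β lam τ ω t :=
  integral_bernoulliWeight_nonneg (fun s => hpos (τ + s)) (neg_nonpos.2 ht)

/-- Shifting the integration variable by `t` turns the weight started at `τ - t` into the fixed
weight on `[-t, 0]`. Apart from the growth factor, `t` then enters only as the limit of integration.
-/
theorem bernoulliCocycle_pullback (t : ℝ≥0) (τ : ℝ) (ω : SamplePath δ) (x : ℝ) :
    bernoulliCocycle β lam t (τ - t) (ω.shift (-t)) x =
      (x * Real.exp (lam * t - δ * ω.1 (-t))) / √(1 + 2 *
        (x * Real.exp (lam * t - δ * ω.1 (-t))) ^ 2 * recentMass β lam τ ω t) := by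
  have e1 : ∀ s, bernoulliWeight δ lam (fun s => β (τ - t + s)) (fun s => (ω.shift (-t)).1 s) s =
      Real.exp (lam * t - δ * ω.1 (-t)) ^ 2 *
        bernoulliWeight δ lam (fun s => β (τ + s)) (fun s => ω.1 s) (s + -t) := by
    intro s
    have := bernoulliWeight_shift (δ := δ) (lam := lam) (b := fun s => β (τ + s))
      (w := fun s => ω.1 s) (-t) s
    simp only [SamplePath.shift_apply, sub_eq_add_neg, add_assoc] at this ⊢
    rw [this, ← Real.exp_nat_mul]
    congr 2
    push_cast
    ring
  have e2 : (∫ s in (0 : ℝ)..t, bernoulliWeight δ lam (fun s => β (τ - t + s))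
      (fun s => (ω.shift (-t)).1 s) s) =
      Real.exp (lam * t - δ * ω.1 (-t)) ^ 2 * recentMass β lam τ ω t := by
    simp_rw [e1]
    rw [intervalIntegral.integral_const_mul, intervalIntegral.integral_comp_add_right
      (bernoulliWeight δ lam (fun s => β (τ + s)) (fun s => ω.1 s)), zero_add, add_neg_cancel,
      recentMass]
  have e3 : lam * t + δ * (ω.shift (-t)).1 t = lam * t - δ * ω.1 (-t) := by
    rw [SamplePath.shift_apply, add_neg_cancel, ω.apply_zero]
    ring
  rw [bernoulliCocycle, bernoulliFlow, e2, e3]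
  congr 3
  ring

theorem abs_bernoulliCocycle_pullback_le (t : ℝ≥0) (τ : ℝ) (ω : SamplePath δ) (x : ℝ)
    (h : 0 < recentMass β lam τ ω t) :
    |bernoulliCocycle β lam t (τ - t) (ω.shift (-t)) x| ≤ 1 / √(2 * recentMass β lam τ ω t) := by
  rw [bernoulliCocycle_pullback]
  exact abs_div_sqrt_le h _

theorem tendsto_integral_exp_atTop (ω : SamplePath δ) :
    Tendsto (fun t : ℝ => ∫ r in (-t)..0, Real.exp (2 * δ * ω.1 r)) atTop atTop := by
  have hω := ω.continuous_coe
  have hc : Continuous fun r => Real.exp (2 * δ * ω.1 r) := by fun_prop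
  refine tendsto_atTop_atTop_of_monotone (fun s t hst => ?_) fun M => ?_
  · have h1 := intervalIntegral.integral_add_adjacent_intervals
      (hc.intervalIntegrable (μ := volume) (-t) (-s)) (hc.intervalIntegrable (-s) 0)
    have h2 : 0 ≤ ∫ r in (-t)..(-s), Real.exp (2 * δ * ω.1 r) :=
      intervalIntegral.integral_nonneg (neg_le_neg hst) fun _ _ => (Real.exp_pos _).le
    change (∫ r in (-s)..0, Real.exp (2 * δ * ω.1 r)) ≤ ∫ r in (-t)..0, Real.exp (2 * δ * ω.1 r)
    linarith
  -- Bounded integrals of a positive function would make it integrable on the half-line, against the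
  -- definition of the regular paths.
  · by_contra! hcon
    have h1 : IntegrableOn (fun r => Real.exp (2 * δ * ω.1 r)) (Iic 0) := by
      refine integrableOn_Iic_of_intervalIntegral_norm_bounded (a := fun t : ℝ => -t)
        (l := atTop) M 0 (fun t => ?_) tendsto_neg_atTop_atBot
        (Eventually.of_forall fun t => ?_)
      · exact (hc.continuousOn.integrableOn_compact isCompact_Icc).mono_set Ioc_subset_Icc_self
      · simp only [Real.norm_eq_abs, abs_of_pos (Real.exp_pos _)]
        exact (hcon t).le
    exact h1.lintegral_lt_top.ne ω.2.2.2.1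

/-- With `max lam 0` one estimate serves both regimes: for `λ ≤ 0` the prefactor is `β₀`, and for
fixed `t` the bound is continuous in `λ`, as the limit `λ → 0+` requires. -/
theorem exp_mul_integral_le_recentMass (hβ : Continuous β) {β₀ : ℝ} (hβ₀ : 0 < β₀)
    (hlow : ∀ s, β₀ ≤ β s) {t : ℝ} (ht : 0 ≤ t) (τ : ℝ) (ω : SamplePath δ) :
    β₀ * Real.exp (-2 * max lam 0 * t) * ∫ r in (-t)..0, Real.exp (2 * δ * ω.1 r) ≤
      recentMass β lam τ ω t := by
  have hω := ω.continuous_coe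
  have hc : Continuous fun r => Real.exp (2 * δ * ω.1 r) := by fun_prop
  rw [recentMass, ← intervalIntegral.integral_const_mul]
  refine intervalIntegral.integral_mono_on (neg_nonpos.2 ht)
    ((hc.const_mul _).intervalIntegrable _ _)
    ((continuous_sampleWeight hβ lam τ ω).intervalIntegrable _ _) fun r hr => ?_
  rw [bernoulliWeight, mul_assoc, ← Real.exp_add]
  refine mul_le_mul (hlow _) (Real.exp_le_exp.2 ?_) (Real.exp_pos _).le (hβ₀.le.trans (hlow _))
  have h1 : -(max lam 0 * t) ≤ lam * r := by
    have h2 : max lam 0 * (-t) ≤ max lam 0 * r :=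
      mul_le_mul_of_nonneg_left hr.1 (le_max_right _ _)
    have h3 : max lam 0 * r ≤ lam * r := mul_le_mul_of_nonpos_right (le_max_left _ _) hr.2
    linarith
  linarith

theorem tendsto_recentMass_atTop_of_nonpos (hβ : Continuous β) {β₀ : ℝ} (hβ₀ : 0 < β₀)
    (hlow : ∀ s, β₀ ≤ β s) (hlam : lam ≤ 0) (τ : ℝ) (ω : SamplePath δ) :
    Tendsto (recentMass β lam τ ω) atTop atTop := by
  refine tendsto_atTop_mono' atTop ?_
    ((tendsto_integral_exp_atTop ω).const_mul_atTop hβ₀)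
  filter_upwards [eventually_ge_atTop 0] with t ht
  have := exp_mul_integral_le_recentMass (lam := lam) hβ hβ₀ hlow ht τ ω
  simpa [max_eq_right hlam] using this

theorem tendsto_one_div_sqrt_atTop {α : Type*} {l : Filter α} {f : α → ℝ}
    (h : Tendsto f l atTop) : Tendsto (fun a => 1 / √(2 * f a)) l (𝓝 0) := by
  simp_rw [one_div]
  exact (Real.tendsto_sqrt_atTop.comp (h.const_mul_atTop two_pos)).inv_tendsto_atTop

theorem integrableOn_exp_path (hδ : 0 < δ) (hlam : 0 < lam) (ω : SamplePath δ) (a : ℝ) :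
    IntegrableOn (fun r => Real.exp (2 * (lam * r + δ * ω.1 r))) (Iic a) := by
  have hω := ω.continuous_coe
  have hc : Continuous fun r => Real.exp (2 * (lam * r + δ * ω.1 r)) := by fun_prop
  -- With this constant `δ|ω(r)| ≤ λ|r|/2` far in the past, so the integrand is at most `e^{λr}`
  -- there.
  have h := Metric.tendsto_nhds.1 ω.2.2.1 (lam / (2 * δ)) (by positivity)
  obtain ⟨R, hR⟩ := eventually_atBot.1 (h.and (eventually_lt_atBot (0 : ℝ)))
  have h1 : IntegrableOn (fun r => Real.exp (2 * (lam * r + δ * ω.1 r))) (Iic R) := by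
    refine (integrableOn_exp_mul_Iic hlam R).mono' hc.aestronglyMeasurable
      ((ae_restrict_iff' measurableSet_Iic).2 (ae_of_all _ fun r hr => ?_))
    obtain ⟨h2, h3⟩ := hR r hr
    rw [Real.norm_eq_abs, abs_of_pos (Real.exp_pos _), Real.exp_le_exp]
    rw [Real.dist_eq, sub_zero, abs_div, abs_of_neg h3, div_lt_iff₀ (neg_pos.2 h3)] at h2
    have h4 : δ * |ω.1 r| ≤ δ * (lam / (2 * δ) * -r) := mul_le_mul_of_nonneg_left h2.le hδ.le
    have h5 : δ * (lam / (2 * δ) * -r) = -(lam * r) / 2 := by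
      field_simp
    have h6 : δ * ω.1 r ≤ δ * |ω.1 r| := mul_le_mul_of_nonneg_left (le_abs_self _) hδ.le
    linarith
  have h2 : IntegrableOn (fun r => Real.exp (2 * (lam * r + δ * ω.1 r))) (Icc R a) :=
    hc.continuousOn.integrableOn_compact isCompact_Icc
  refine (h1.union h2).mono_set fun r hr => ?_
  rcases le_total r R with h | h
  · exact Or.inl h
  · exact Or.inr ⟨h, hr⟩

theorem integrableOn_sampleWeight (hδ : 0 < δ) (hlam : 0 < lam) (hβ : Continuous β) {β₁ : ℝ}
    (hpos : ∀ s, 0 < β s) (hup : ∀ s, β s ≤ β₁) (τ : ℝ) (ω : SamplePath δ) (a : ℝ) :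
    IntegrableOn (bernoulliWeight δ lam (fun s => β (τ + s)) (fun s => ω.1 s)) (Iic a) := by
  refine ((integrableOn_exp_path hδ hlam ω a).const_mul β₁).mono'
    (continuous_sampleWeight hβ lam τ ω).aestronglyMeasurable (ae_of_all _ fun r => ?_)
  rw [Real.norm_eq_abs, abs_of_pos (bernoulliWeight_pos (fun s => hpos (τ + s)) r)]
  exact mul_le_mul_of_nonneg_right (hup _) (Real.exp_pos _).le

end Pullback

/-! ### The positive random equilibrium -/

section Equilibrium

variable {δ lam : ℝ} {β : ℝ → ℝ} {β₀ β₁ : ℝ}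

theorem tendsto_recentMass_pastMass (hδ : 0 < δ) (hlam : 0 < lam) (hβ : Continuous β)
    (hpos : ∀ s, 0 < β s) (hup : ∀ s, β s ≤ β₁) (τ : ℝ) (ω : SamplePath δ) :
    Tendsto (recentMass β lam τ ω) atTop (𝓝 (pastMass β lam τ ω)) :=
  intervalIntegral_tendsto_integral_Iic 0 (integrableOn_sampleWeight hδ hlam hβ hpos hup τ ω 0)
    tendsto_neg_atTop_atBot

theorem recentMass_le_pastMass (hδ : 0 < δ) (hlam : 0 < lam) (hβ : Continuous β)
    (hpos : ∀ s, 0 < β s) (hup : ∀ s, β s ≤ β₁) (τ : ℝ) (ω : SamplePath δ) {t : ℝ} (ht : 0 ≤ t) :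
    recentMass β lam τ ω t ≤ pastMass β lam τ ω := by
  rw [recentMass, intervalIntegral.integral_of_le (neg_nonpos.2 ht)]
  exact setIntegral_mono_set (integrableOn_sampleWeight hδ hlam hβ hpos hup τ ω 0)
    (ae_of_all _ fun r => (bernoulliWeight_pos (fun s => hpos (τ + s)) r).le)
    Ioc_subset_Iic_self.eventuallyLE

theorem recentMass_pos (hβ : Continuous β) (hpos : ∀ s, 0 < β s) (τ : ℝ) (ω : SamplePath δ)
    {t : ℝ} (ht : 0 < t) : 0 < recentMass β lam τ ω t :=
  intervalIntegral.intervalIntegral_pos_of_pos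
    ((continuous_sampleWeight hβ lam τ ω).intervalIntegrable _ _)
    (fun r => bernoulliWeight_pos (fun s => hpos (τ + s)) r) (neg_lt_zero.2 ht)

theorem pastMass_pos (hδ : 0 < δ) (hlam : 0 < lam) (hβ : Continuous β)
    (hpos : ∀ s, 0 < β s) (hup : ∀ s, β s ≤ β₁) (τ : ℝ) (ω : SamplePath δ) :
    0 < pastMass β lam τ ω :=
  (recentMass_pos hβ hpos τ ω one_pos).trans_le
    (recentMass_le_pastMass hδ hlam hβ hpos hup τ ω zero_le_one)

theorem positiveEquilibrium_pos (hδ : 0 < δ) (hlam : 0 < lam) (hβ : Continuous β)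
    (hpos : ∀ s, 0 < β s) (hup : ∀ s, β s ≤ β₁) (τ : ℝ) (ω : SamplePath δ) :
    0 < positiveEquilibrium β lam τ ω := by
  have := pastMass_pos hδ hlam hβ hpos hup τ ω
  unfold positiveEquilibrium
  positivity

theorem measurable_positiveEquilibrium (hβ : Continuous β) (lam τ : ℝ) :
    Measurable (positiveEquilibrium (δ := δ) β lam τ) := by
  have h : Measurable (pastMass (δ := δ) β lam τ) :=
    measurable_integral_of_continuous
      (f := fun r (ω : SamplePath δ) =>
        bernoulliWeight δ lam (fun s => β (τ + s)) (fun s => ω.1 s) r)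
      (fun ω => continuous_sampleWeight hβ lam τ ω)
      (fun r => by
        have := SamplePath.measurable_eval (δ := δ) r
        unfold bernoulliWeight
        fun_prop) _
  unfold positiveEquilibrium
  fun_prop

theorem tendsto_upperBound (hδ : 0 < δ) (hlam : 0 < lam) (hβ : Continuous β)
    (hpos : ∀ s, 0 < β s) (hup : ∀ s, β s ≤ β₁) (τ : ℝ) (ω : SamplePath δ) :
    Tendsto (fun t => 1 / √(2 * recentMass β lam τ ω t)) atTop
      (𝓝 (positiveEquilibrium β lam τ ω)) := by
  have h1 := tendsto_recentMass_pastMass hδ hlam hβ hpos hup τ ω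
  have h2 := pastMass_pos hδ hlam hβ hpos hup τ ω
  exact tendsto_const_nhds.div ((h1.const_mul 2).sqrt) (Real.sqrt_pos.2 (by positivity)).ne'

theorem tendsto_growth_atTop (hlam : 0 < lam) (ω : SamplePath δ) :
    Tendsto (fun t => Real.exp (lam * t - δ * ω.1 (-t))) atTop atTop := by
  have h1 := (tendsto_div_atBot_iff (fun t => ω.1 t)).1 ω.2.2.1
  have h2 : Tendsto (fun t => lam - δ * (ω.1 (-t) / t)) atTop (𝓝 (lam - δ * 0)) :=
    tendsto_const_nhds.sub (h1.const_mul δ)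
  rw [mul_zero, sub_zero] at h2
  refine Real.tendsto_exp_atTop.comp ((h2.pos_mul_atTop hlam tendsto_id).congr' ?_)
  filter_upwards [eventually_gt_atTop 0] with t ht
  simp only [id]
  field_simp

/-- The state is `1/√(y⁻² + 2K)` with `y → ∞`, since `λt` beats `δω(-t)`; the dependence on `x`
disappears in the limit. -/
theorem tendsto_bernoulliCocycle_pullback (hδ : 0 < δ) (hlam : 0 < lam) (hβ : Continuous β)
    (hpos : ∀ s, 0 < β s) (hup : ∀ s, β s ≤ β₁) (τ : ℝ) (ω : SamplePath δ) {x : ℝ} (hx : 0 < x) :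
    Tendsto (fun t : ℝ≥0 => bernoulliCocycle β lam t (τ - t) (ω.shift (-t)) x) atTop
      (𝓝 (positiveEquilibrium β lam τ ω)) := by
  have h1 := tendsto_recentMass_pastMass hδ hlam hβ hpos hup τ ω
  have h2 := pastMass_pos hδ hlam hβ hpos hup τ ω
  have h3 : Tendsto (fun t => ((x * Real.exp (lam * t - δ * ω.1 (-t))) ^ 2)⁻¹) atTop (𝓝 0) :=
    ((tendsto_pow_atTop two_ne_zero).comp
      ((tendsto_growth_atTop hlam ω).const_mul_atTop hx)).inv_tendsto_atTop
  have h4 := (h3.add (h1.const_mul 2)).sqrt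
  rw [zero_add] at h4
  have h5 := (tendsto_const_nhds (x := (1 : ℝ))).div h4 (Real.sqrt_pos.2 (by positivity)).ne'
  refine (h5.comp (NNReal.tendsto_coe_atTop.2 tendsto_id)).congr fun t => ?_
  rw [bernoulliCocycle_pullback, div_sqrt_eq (mul_pos hx (Real.exp_pos _))]
  rfl

/-- The past mass along the shifted data. -/
theorem pastMass_shift (hδ : 0 < δ) (hlam : 0 < lam) (hβ : Continuous β)
    (hpos : ∀ s, 0 < β s) (hup : ∀ s, β s ≤ β₁) (τ t : ℝ) (ω : SamplePath δ) :
    pastMass β lam (τ + t) (ω.shift t) = Real.exp (-(2 * (lam * t + δ * ω.1 t))) *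
      (pastMass β lam τ ω + ∫ r in (0 : ℝ)..t,
        bernoulliWeight δ lam (fun s => β (τ + s)) (fun s => ω.1 s) r) := by
  have hi := fun a => integrableOn_sampleWeight hδ hlam hβ hpos hup τ ω a
  have e1 : ∀ s, bernoulliWeight δ lam (fun s => β (τ + t + s)) (fun s => (ω.shift t).1 s) s =
      Real.exp (-(2 * (lam * t + δ * ω.1 t))) *
        bernoulliWeight δ lam (fun s => β (τ + s)) (fun s => ω.1 s) (s + t) := by
    intro s
    have := bernoulliWeight_shift (δ := δ) (lam := lam) (b := fun s => β (τ + s))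
      (w := fun s => ω.1 s) t s
    simpa only [SamplePath.shift_apply, add_assoc] using this
  have e2 : (∫ r in Iic (0 : ℝ), bernoulliWeight δ lam (fun s => β (τ + s)) (fun s => ω.1 s)
      (r + t)) = ∫ r in Iic t, bernoulliWeight δ lam (fun s => β (τ + s)) (fun s => ω.1 s) r := by
    rw [← (measurePreserving_add_right (volume : Measure ℝ) t).setIntegral_preimage_emb
      (measurableEmbedding_addRight t) _ (Iic t)]
    congr 2
    ext s
    simp
  rw [pastMass]
  simp_rw [e1]
  rw [integral_const_mul, e2, pastMass, ← intervalIntegral.integral_Iic_sub_Iic (hi 0) (hi t)]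
  ring

/-- In the variable `x⁻²` the flow is affine: add `2I`, then multiply by `e^{-2(λt+δω(t))}`. By
`pastMass_shift`, twice the past mass transforms in the same way. -/
theorem positiveEquilibrium_isCompleteQuasiSolution (hδ : 0 < δ) (hlam : 0 < lam)
    (hβ : Continuous β) (hpos : ∀ s, 0 < β s) (hup : ∀ s, β s ≤ β₁) :
    IsCompleteQuasiSolution (δ := δ) (bernoulliCocycle β lam) (positiveEquilibrium β lam) := by
  intro t τ ω
  have hM := pastMass_pos hδ hlam hβ hpos hup τ ω
  have hI := integral_bernoulliWeight_nonneg (δ := δ) (lam := lam) (w := fun s => ω.1 s)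
    (fun s => hpos (τ + s)) t.2
  rw [bernoulliCocycle, bernoulliFlow, positiveEquilibrium, positiveEquilibrium,
    pastMass_shift hδ hlam hβ hpos hup]
  change 0 ≤ ∫ r in (0 : ℝ)..(t : ℝ), _ at hI
  set M := pastMass β lam τ ω
  set I := ∫ r in (0 : ℝ)..(t : ℝ), bernoulliWeight δ lam (fun s => β (τ + s)) (fun s => ω.1 s) r
  have e1 : 1 + 2 * (1 / √(2 * M)) ^ 2 * I = (2 * (M + I)) / (2 * M) := by
    rw [div_pow, Real.sq_sqrt (by positivity)]
    field_simp
  have e2 : 2 * (Real.exp (-(2 * (lam * t + δ * ω.1 t))) * (M + I)) =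
      Real.exp (-(lam * t + δ * ω.1 t)) ^ 2 * (2 * (M + I)) := by
    rw [← Real.exp_nat_mul, show ((2 : ℕ) : ℝ) * -(lam * t + δ * ω.1 t) =
      -(2 * (lam * t + δ * ω.1 t)) by push_cast; ring]
    ring
  have h1 : 0 < √(2 * M) := Real.sqrt_pos.2 (by positivity)
  have h2 : 0 < √(2 * (M + I)) := Real.sqrt_pos.2 (by positivity)
  rw [e1, e2, Real.sqrt_div (by positivity), Real.sqrt_mul (sq_nonneg _),
    Real.sqrt_sq (Real.exp_pos _).le, Real.exp_neg]
  field_simp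

theorem IsCompleteQuasiSolution.neg {ξ : ℝ → SamplePath δ → ℝ}
    (h : IsCompleteQuasiSolution (bernoulliCocycle β lam) ξ) :
    IsCompleteQuasiSolution (bernoulliCocycle β lam) fun τ ω => -ξ τ ω := by
  intro t τ ω
  change bernoulliCocycle β lam t τ ω (-ξ τ ω) = -ξ (τ + t) (ω.shift t)
  rw [← h t τ ω]
  exact bernoulliFlow_neg _ _

theorem exp_neg_le_pastMass (hδ : 0 < δ) (hlam : 0 < lam) (hβ : Continuous β) (hβ₀ : 0 < β₀)
    (hlow : ∀ s, β₀ ≤ β s) (hup : ∀ s, β s ≤ β₁) (τ : ℝ) {ω : SamplePath δ} {A : ℝ}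
    (hA : ∀ r ∈ Icc (-1 : ℝ) 0, -A ≤ δ * ω.1 r) :
    β₀ * Real.exp (-2 * (lam + A)) ≤ pastMass β lam τ ω := by
  have hpos : ∀ s, 0 < β s := fun s => hβ₀.trans_le (hlow s)
  refine le_trans ?_ (recentMass_le_pastMass hδ hlam hβ hpos hup τ ω zero_le_one)
  have h1 : (∫ _ in (-1 : ℝ)..0, β₀ * Real.exp (-2 * (lam + A))) =
      β₀ * Real.exp (-2 * (lam + A)) := by simp
  rw [← h1]
  refine intervalIntegral.integral_mono_on (by norm_num) (by simp)
    ((continuous_sampleWeight hβ lam τ ω).intervalIntegrable _ _) fun r hr => ?_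
  refine mul_le_mul (hlow _) (Real.exp_le_exp.2 ?_) (Real.exp_pos _).le (hpos _).le
  have h2 := hA r hr
  have h3 : lam * (-1) ≤ lam * r := mul_le_mul_of_nonneg_left hr.1 hlam.le
  linarith

/-- An upper bound for the equilibrium needs only a lower bound for the past mass, and the last unit
of time suffices. There sublinear growth bounds the equilibrium by a constant times `e^{-ct/2}`,
which leaves `e^{ct/2}`. -/
theorem tendsto_exp_mul_positiveEquilibrium_shift (hδ : 0 < δ) (hlam : 0 < lam)
    (hβ : Continuous β) (hβ₀ : 0 < β₀) (hlow : ∀ s, β₀ ≤ β s) (hup : ∀ s, β s ≤ β₁)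
    {c : ℝ} (hc : 0 < c) (τ : ℝ) (ω : SamplePath δ) :
    Tendsto (fun t => Real.exp (c * t) * positiveEquilibrium β lam (τ + t) (ω.shift t))
      atBot (𝓝 0) := by
  -- The shifted path involves `ω(r+t)` and `ω(t)`; each may cost a rate `c/4`, so half of `c` is
  -- left over.
  have h := Metric.tendsto_nhds.1 ω.2.2.1 (c / (4 * δ)) (by positivity)
  obtain ⟨R, hR⟩ := eventually_atBot.1 (h.and (eventually_lt_atBot (0 : ℝ)))
  have hbd : ∀ r ≤ R, δ * |ω.1 r| ≤ -(c / 4) * r := by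
    intro r hr
    obtain ⟨h1, h2⟩ := hR r hr
    rw [Real.dist_eq, sub_zero, abs_div, abs_of_neg h2, div_lt_iff₀ (neg_pos.2 h2)] at h1
    have h3 := mul_le_mul_of_nonneg_left h1.le hδ.le
    have h4 : δ * (c / (4 * δ) * -r) = -(c / 4) * r := by field_simp
    linarith
  set D := 1 / √(2 * β₀) * Real.exp (lam + c / 4)
  have hlim : Tendsto (fun t => D * Real.exp (c / 2 * t)) atBot (𝓝 0) := by
    have h1 : Tendsto (fun t => c / 2 * t) atBot atBot :=
      tendsto_id.const_mul_atBot (by positivity)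
    simpa using (Real.tendsto_exp_atBot.comp h1).const_mul D
  refine tendsto_of_tendsto_of_tendsto_of_le_of_le' tendsto_const_nhds hlim
    (Eventually.of_forall fun t => ?_) ?_
  · have := positiveEquilibrium_pos hδ hlam hβ (fun s => hβ₀.trans_le (hlow s)) hup (τ + t)
      (ω.shift t)
    positivity
  · filter_upwards [eventually_le_atBot R] with t ht
    have hA : ∀ r ∈ Icc (-1 : ℝ) 0, -(-(c / 2) * t + c / 4) ≤ δ * (ω.shift t).1 r := by
      intro r hr
      rw [SamplePath.shift_apply, mul_sub]
      have h1 := hbd t ht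
      have h2 := hbd (r + t) (by linarith [hr.2])
      have h3 : -(δ * |ω.1 (r + t)|) ≤ δ * ω.1 (r + t) := by
        rw [← mul_neg]
        exact mul_le_mul_of_nonneg_left (neg_abs_le _) hδ.le
      have h4 : δ * ω.1 t ≤ δ * |ω.1 t| := mul_le_mul_of_nonneg_left (le_abs_self _) hδ.le
      have h5 : c / 4 * (-1) ≤ c / 4 * r := mul_le_mul_of_nonneg_left hr.1 (by positivity)
      nlinarith
    have h1 := exp_neg_le_pastMass hδ hlam hβ hβ₀ hlow hup (τ + t) hA
    have e : 2 * (β₀ * Real.exp (-2 * (lam + (-(c / 2) * t + c / 4)))) =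
        2 * β₀ * Real.exp (-(lam + (-(c / 2) * t + c / 4))) ^ 2 := by
      rw [← Real.exp_nat_mul, ← mul_assoc]
      congr 2
      push_cast
      ring
    have h2 : positiveEquilibrium β lam (τ + t) (ω.shift t) ≤
        1 / √(2 * β₀) * Real.exp (lam + (-(c / 2) * t + c / 4)) := by
      have h3 : 1 / √(2 * β₀) * Real.exp (lam + (-(c / 2) * t + c / 4)) =
          1 / √(2 * (β₀ * Real.exp (-2 * (lam + (-(c / 2) * t + c / 4))))) := by
        rw [e, Real.sqrt_mul (mul_nonneg two_pos.le hβ₀.le), Real.sqrt_sq (Real.exp_pos _).le, Real.exp_neg]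
        field_simp
      rw [h3, positiveEquilibrium]
      refine one_div_le_one_div_of_le (Real.sqrt_pos.2 (by positivity))
        (Real.sqrt_le_sqrt (by linarith))
    calc _ ≤ Real.exp (c * t) * (1 / √(2 * β₀) * Real.exp (lam + (-(c / 2) * t + c / 4))) :=
          mul_le_mul_of_nonneg_left h2 (Real.exp_pos _).le
      _ = 1 / √(2 * β₀) * (Real.exp (c * t) * Real.exp (lam + (-(c / 2) * t + c / 4))) := by ring
      _ = D * Real.exp (c / 2 * t) := by
          simp only [D]
          rw [mul_assoc, ← Real.exp_add, ← Real.exp_add]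
          congr 2
          ring

theorem tendsto_positiveEquilibrium_zero (hδ : 0 < δ) (hβ : Continuous β) (hβ₀ : 0 < β₀)
    (hlow : ∀ s, β₀ ≤ β s) (hup : ∀ s, β s ≤ β₁) (τ : ℝ) (ω : SamplePath δ) :
    Tendsto (fun lam => positiveEquilibrium β lam τ ω) (𝓝[>] 0) (𝓝 0) := by
  refine tendsto_one_div_sqrt_atTop (tendsto_atTop.2 fun M => ?_)
  -- First fix a horizon `t` whose mass at `λ = 0` exceeds `M`; the lower bound then stays above `M`
  -- for small `λ` by continuity.
  obtain ⟨t, hM, ht⟩ := ((((tendsto_integral_exp_atTop ω).const_mul_atTop hβ₀).eventually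
    (eventually_gt_atTop M)).and (eventually_ge_atTop 0)).exists
  have hcont : Continuous fun lam : ℝ => β₀ * Real.exp (-2 * max lam 0 * t) *
      ∫ r in (-t)..0, Real.exp (2 * δ * ω.1 r) := by fun_prop
  have h1 : ∀ᶠ lam in 𝓝 (0 : ℝ), M < β₀ * Real.exp (-2 * max lam 0 * t) *
      ∫ r in (-t)..0, Real.exp (2 * δ * ω.1 r) := by
    refine (hcont.tendsto 0).eventually (lt_mem_nhds ?_)
    simpa using hM
  filter_upwards [nhdsWithin_le_nhds h1, self_mem_nhdsWithin] with lam h2 hlam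
  exact (h2.le.trans (exp_mul_integral_le_recentMass hβ hβ₀ hlow ht τ ω)).trans
    (recentMass_le_pastMass hδ hlam hβ (fun s => hβ₀.trans_le (hlow s)) hup τ ω ht)

end Equilibrium

/-! ### Recurrence of weighted averages over the past -/

section Recurrence

variable {β k : ℝ → ℝ} {β₀ β₁ : ℝ}

theorem IsAlmostPeriodic.comp_uniformContinuousOn {h : ℝ → ℝ} {G : ℝ → ℝ} {S : Set ℝ}
    (hh : IsAlmostPeriodic h) (hG : UniformContinuousOn G S) (hS : ∀ τ, h τ ∈ S) :
    IsAlmostPeriodic fun τ => G (h τ) := by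
  intro ε hε
  obtain ⟨d, hd, hG'⟩ := Metric.uniformContinuousOn_iff.1 hG ε hε
  obtain ⟨l, hl, H⟩ := hh d hd
  refine ⟨l, hl, fun a => ?_⟩
  obtain ⟨t₀, ht₀, H'⟩ := H a
  exact ⟨t₀, ht₀, fun τ => hG' _ (hS _) _ (hS _) (H' τ)⟩

theorem integrableOn_mul_of_bounded {a : ℝ} (hβ : Measurable β) (hb : ∀ s, |β s| ≤ β₁)
    (hk : IntegrableOn k (Iic a)) : IntegrableOn (fun r => β r * k r) (Iic a) :=
  hk.bdd_mul hβ.aestronglyMeasurable (ae_of_all _ hb)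

theorem IsAlmostPeriodic.integral_mul (hβ : Measurable β) (hb : ∀ s, |β s| ≤ β₁)
    (hk0 : ∀ r, 0 ≤ k r) (hk : IntegrableOn k (Iic 0)) (h : IsAlmostPeriodic β) :
    IsAlmostPeriodic fun τ => ∫ r in Iic (0 : ℝ), β (τ + r) * k r := by
  intro ε hε
  set c := ∫ r in Iic (0 : ℝ), k r with hc
  have hc0 : 0 ≤ c := integral_nonneg hk0
  obtain ⟨l, hl, H⟩ := h (ε / (c + 1)) (by positivity)
  refine ⟨l, hl, fun a => ?_⟩
  obtain ⟨t₀, ht₀, H'⟩ := H a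
  refine ⟨t₀, ht₀, fun τ => ?_⟩
  have hi : ∀ τ, IntegrableOn (fun r => β (τ + r) * k r) (Iic 0) := fun τ =>
    integrableOn_mul_of_bounded (β := fun r => β (τ + r)) (by fun_prop) (fun s => hb _) hk
  rw [← integral_sub (hi _) (hi _)]
  have h1 : |∫ r in Iic (0 : ℝ), (β (τ + t₀ + r) * k r - β (τ + r) * k r)| ≤
      ∫ r in Iic (0 : ℝ), ε / (c + 1) * k r := by
    rw [← Real.norm_eq_abs]
    refine norm_integral_le_of_norm_le (hk.const_mul _) (ae_of_all _ fun r => ?_)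
    rw [Real.norm_eq_abs, ← sub_mul, abs_mul, abs_of_nonneg (hk0 r)]
    refine mul_le_mul_of_nonneg_right ?_ (hk0 r)
    rw [add_right_comm]
    exact (H' (τ + r)).le
  refine h1.trans_lt ?_
  rw [integral_const_mul, ← hc, div_mul_eq_mul_div, div_lt_iff₀ (by positivity)]
  nlinarith

/-- If `β` is recurrent with values in `[β₀, β₁] ⊆ (0, ∞)`, so is every continuous function of
its averages over the past. -/
theorem RecurrenceType.Holds.comp_integral_mul {κ : RecurrenceType} (h : κ.Holds β)
    (hβ : Measurable β) (hβ₀ : 0 < β₀) (hb : ∀ s, β₀ ≤ β s ∧ β s ≤ β₁) (hk0 : ∀ r, 0 ≤ k r)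
    (hk : IntegrableOn k (Iic 0)) (hkpos : 0 < ∫ r in Iic (0 : ℝ), k r) {G : ℝ → ℝ}
    (hG : ContinuousOn G (Ioi 0)) :
    κ.Holds fun τ => G (∫ r in Iic (0 : ℝ), β (τ + r) * k r) := by
  have habs : ∀ {x : ℝ}, β₀ ≤ x ∧ x ≤ β₁ → |x| ≤ β₁ := fun hx => by
    rw [abs_of_pos (hβ₀.trans_le hx.1)]
    exact hx.2
  have hmem : ∀ α : ℝ → ℝ, Measurable α → (∀ s, β₀ ≤ α s ∧ α s ≤ β₁) →
      (∫ r in Iic (0 : ℝ), α r * k r) ∈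
        Icc (β₀ * ∫ r in Iic (0 : ℝ), k r) (β₁ * ∫ r in Iic (0 : ℝ), k r) := by
    intro α hα hαb
    have hi := integrableOn_mul_of_bounded hα (fun s => habs (hαb s)) hk
    rw [← integral_const_mul, ← integral_const_mul]
    exact ⟨integral_mono (hk.const_mul _) hi fun r =>
        mul_le_mul_of_nonneg_right (hαb r).1 (hk0 r),
      integral_mono hi (hk.const_mul _) fun r => mul_le_mul_of_nonneg_right (hαb r).2 (hk0 r)⟩
  have hsub : Icc (β₀ * ∫ r in Iic (0 : ℝ), k r) (β₁ * ∫ r in Iic (0 : ℝ), k r) ⊆ Ioi 0 :=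
    fun x hx => (mul_pos hβ₀ hkpos).trans_le hx.1
  -- Almost automorphy is pointwise convergence in two directions; dominated convergence carries
  -- both over to the averages.
  have hconv : ∀ (f : ℕ → ℝ → ℝ) (g : ℝ → ℝ), (∀ n, Measurable (f n)) →
      (∀ n s, β₀ ≤ f n s ∧ f n s ≤ β₁) → Measurable g → (∀ s, β₀ ≤ g s ∧ g s ≤ β₁) →
      (∀ s, Tendsto (fun n => f n s) atTop (𝓝 (g s))) →
      Tendsto (fun n => G (∫ r in Iic (0 : ℝ), f n r * k r)) atTop
        (𝓝 (G (∫ r in Iic (0 : ℝ), g r * k r))) := by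
    intro f g hf hfb hgm hgb hlim
    have hpos := hsub (hmem g hgm hgb)
    refine ((hG.continuousAt (Ioi_mem_nhds hpos)).tendsto.comp
      (tendsto_integral_of_dominated_convergence (fun r => β₁ * k r) (fun n => ?_)
        (hk.const_mul _) (fun n => ae_of_all _ fun r => ?_) (ae_of_all _ fun r => ?_)))
    · exact (hf n).aestronglyMeasurable.mul hk.aestronglyMeasurable
    · rw [Real.norm_eq_abs, abs_mul, abs_of_nonneg (hk0 r)]
      exact mul_le_mul_of_nonneg_right (habs (hfb n r)) (hk0 r)
    · exact (hlim r).mul_const _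
  cases κ with
  | periodic T =>
    refine ⟨h.1, fun τ => ?_⟩
    have e : ∀ r, β (τ + T + r) = β (τ + r) := fun r => by
      rw [add_right_comm]
      exact h.2 _
    simp only [e]
  | almostPeriodic =>
    exact (IsAlmostPeriodic.integral_mul hβ (fun s => habs (hb s)) hk0 hk h).comp_uniformContinuousOn
      (isCompact_Icc.uniformContinuousOn_of_continuous (hG.mono hsub))
      (fun τ => hmem (fun r => β (τ + r)) (by fun_prop) fun s => hb _)
  | almostAutomorphic =>
    intro u
    obtain ⟨n, hn, ζ, hζ⟩ := h u
    -- The limit `ζ` is only a pointwise limit and need not be continuous, but measurability and the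
    -- bounds `β₀`, `β₁` survive, and these are all that `hconv` asks for.
    have hζm : Measurable ζ := measurable_of_tendsto_metrizable
      (f := fun m τ => β (τ + u (n m))) (fun m => by fun_prop)
      (tendsto_pi_nhds.2 fun τ => (hζ τ).1)
    have hζb : ∀ s, β₀ ≤ ζ s ∧ ζ s ≤ β₁ := fun s =>
      ⟨ge_of_tendsto' (hζ s).1 fun m => (hb _).1, le_of_tendsto' (hζ s).1 fun m => (hb _).2⟩
    refine ⟨n, hn, fun τ => G (∫ r in Iic (0 : ℝ), ζ (τ + r) * k r), fun τ => ⟨?_, ?_⟩⟩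
    · refine hconv (fun m r => β (τ + u (n m) + r)) (fun r => ζ (τ + r)) (fun m => by fun_prop)
        (fun m s => hb _) (by fun_prop) (fun s => hζb _) fun s => ?_
      simpa only [add_right_comm] using (hζ (τ + s)).1
    · refine hconv (fun m r => ζ (τ - u (n m) + r)) (fun r => β (τ + r)) (fun m => by fun_prop)
        (fun m s => hζb _) (by fun_prop) (fun s => hb _) fun s => ?_
      have := (hζ (τ + s)).2
      simpa only [sub_eq_add_neg, add_right_comm] using this

theorem RecurrenceType.Holds.const_zero {κ : RecurrenceType} {f : ℝ → ℝ} (h : κ.Holds f) :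
    κ.Holds fun _ => 0 := by
  cases κ with
  | periodic T => exact ⟨h.1, fun _ => rfl⟩
  | almostPeriodic => exact fun ε hε => ⟨1, one_pos, fun a => ⟨a, by simp, fun _ => by simpa⟩⟩
  | almostAutomorphic =>
    exact fun _ => ⟨id, strictMono_id, fun _ => 0, fun _ =>
      ⟨tendsto_const_nhds, tendsto_const_nhds⟩⟩

theorem RecurrenceType.Holds.positiveEquilibrium {κ : RecurrenceType} (h : κ.Holds β) {δ lam : ℝ}
    (hδ : 0 < δ) (hlam : 0 < lam) (hβ : Continuous β) (hβ₀ : 0 < β₀)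
    (hb : ∀ s, β₀ ≤ β s ∧ β s ≤ β₁) (ω : SamplePath δ) :
    κ.Holds (fun τ => positiveEquilibrium β lam τ ω) ∧
      κ.Holds (fun τ => -positiveEquilibrium β lam τ ω) := by
  have hk := integrableOn_exp_path hδ hlam ω 0
  have hkpos : 0 < ∫ r in Iic (0 : ℝ), Real.exp (2 * (lam * r + δ * ω.1 r)) := by
    rw [setIntegral_pos_iff_support_of_nonneg_ae (ae_of_all _ fun r => (Real.exp_pos _).le) hk]
    have : Function.support (fun r => Real.exp (2 * (lam * r + δ * ω.1 r))) = univ := by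
      ext r
      simp [(Real.exp_pos _).ne']
    simp [this]
  have hG : ContinuousOn (fun y : ℝ => 1 / √(2 * y)) (Ioi 0) :=
    continuousOn_const.div (Continuous.continuousOn (by fun_prop)) fun y hy =>
      (Real.sqrt_pos.2 (mul_pos two_pos hy)).ne'
  exact ⟨h.comp_integral_mul hβ.measurable hβ₀ hb (fun r => (Real.exp_pos _).le) hk hkpos hG,
    h.comp_integral_mul hβ.measurable hβ₀ hb (fun r => (Real.exp_pos _).le) hk hkpos hG.neg⟩

end Recurrence

/-! ### The pitchfork bifurcation -/

theorem tendsto_hausdorffSemiDist_zero {S : ℝ≥0 → Set ℝ} {A : Set ℝ} {ρ : ℝ≥0 → ℝ}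
    (hρ : Tendsto ρ atTop (𝓝 0)) (h : ∀ᶠ t in atTop, ∀ x ∈ S t, ∃ a ∈ A, |x - a| ≤ ρ t) :
    Tendsto (fun t => hausdorffSemiDist (S t) A) atTop (𝓝 0) := by
  have h1 : Tendsto (fun t => ENNReal.ofReal (ρ t)) atTop (𝓝 0) := by
    simpa using ENNReal.tendsto_ofReal hρ
  refine tendsto_of_tendsto_of_tendsto_of_le_of_le' tendsto_const_nhds h1
    (Eventually.of_forall fun _ => zero_le) ?_
  filter_upwards [h] with t ht
  refine iSup₂_le fun x hx => ?_
  obtain ⟨a, ha, hxa⟩ := ht x hx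
  refine (Metric.infEDist_le_edist_of_mem ha).trans ?_
  rw [edist_dist]
  exact ENNReal.ofReal_le_ofReal hxa

/-- This formula reduces the measurability of a random interval to that of its end points. -/
theorem infDist_Icc {a b : ℝ} (hab : a ≤ b) (x : ℝ) :
    Metric.infDist x (Icc a b) = max 0 (max (a - x) (x - b)) := by
  refine le_antisymm ?_ ((Metric.le_infDist (nonempty_Icc.2 hab)).2 fun y hy => ?_)
  · refine (Metric.infDist_le_dist_of_mem (s := Icc a b) (y := max a (min x b))
      ⟨le_max_left _ _, max_le hab (min_le_right _ _)⟩).trans ?_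
    rw [Real.dist_eq]
    grind
  · rw [Real.dist_eq]
    have := hy.1
    have := hy.2
    grind

section Bifurcation

variable {δ lam : ℝ} {β : ℝ → ℝ} {β₀ β₁ : ℝ}

theorem bernoulliCocycle_isFixedPoint_zero :
    IsFixedPoint (bernoulliCocycle (δ := δ) β lam) 0 := fun _ _ _ => bernoulliFlow_zero _

theorem tendsto_upperBound_zero (hβ : Continuous β) (hβ₀ : 0 < β₀) (hlow : ∀ s, β₀ ≤ β s)
    (hlam : lam ≤ 0) (τ : ℝ) (ω : SamplePath δ) :
    Tendsto (fun t : ℝ≥0 => 1 / √(2 * recentMass β lam τ ω t)) atTop (𝓝 0) :=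
  (tendsto_one_div_sqrt_atTop (tendsto_recentMass_atTop_of_nonpos hβ hβ₀ hlow hlam τ ω)).comp
    (NNReal.tendsto_coe_atTop.2 tendsto_id)

theorem eventually_abs_bernoulliCocycle_pullback_le (hβ : Continuous β) (hpos : ∀ s, 0 < β s)
    (τ : ℝ) (ω : SamplePath δ) : ∀ᶠ t : ℝ≥0 in atTop, ∀ x,
      |bernoulliCocycle β lam t (τ - t) (ω.shift (-t)) x| ≤ 1 / √(2 * recentMass β lam τ ω t) := by
  filter_upwards [eventually_gt_atTop 0] with t ht x
  exact abs_bernoulliCocycle_pullback_le t τ ω x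
    (recentMass_pos hβ hpos τ ω (NNReal.coe_pos.2 ht))

theorem IsCompleteQuasiSolution.pullback_eq {Φ : CocycleMap δ} {ξ : ℝ → SamplePath δ → ℝ}
    (h : IsCompleteQuasiSolution Φ ξ) (t : ℝ≥0) (τ : ℝ) (ω : SamplePath δ) :
    Φ t (τ - t) (ω.shift (-t)) (ξ (τ - t) (ω.shift (-t))) = ξ τ ω := by
  rw [h, SamplePath.shift_shift_neg, sub_add_cancel]

/-- The value at `(τ, ω)` is a pullback image from every earlier time, so it obeys the bound
`1/√(2K)`, which tends to `0` however the earlier values behave. -/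
theorem IsCompleteQuasiSolution.eq_zero_of_nonpos (hβ : Continuous β) (hβ₀ : 0 < β₀)
    (hlow : ∀ s, β₀ ≤ β s) (hlam : lam ≤ 0) {ξ : ℝ → SamplePath δ → ℝ}
    (h : IsCompleteQuasiSolution (bernoulliCocycle β lam) ξ) : ξ = fun _ _ => 0 := by
  funext τ ω
  have h1 : |ξ τ ω| ≤ 0 := by
    refine ge_of_tendsto (tendsto_upperBound_zero hβ hβ₀ hlow hlam τ ω) ?_
    filter_upwards [eventually_abs_bernoulliCocycle_pullback_le (lam := lam) hβ
      (fun s => hβ₀.trans_le (hlow s)) τ ω] with t ht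
    have := ht (ξ (τ - t) (ω.shift (-t)))
    rwa [h.pullback_eq] at this
  exact abs_nonpos_iff.1 h1

theorem bernoulliCocycle_isPullbackAsympStable (hβ : Continuous β) (hβ₀ : 0 < β₀)
    (hlow : ∀ s, β₀ ≤ β s) (hlam : lam ≤ 0) :
    IsPullbackAsympStableFixedPoint (bernoulliCocycle (δ := δ) β lam) univ 0 := by
  have hpos : ∀ s, 0 < β s := fun s => hβ₀.trans_le (hlow s)
  refine ⟨bernoulliCocycle_isFixedPoint_zero, fun τ ω ε hε => ?_, fun τ ω x _ => ?_⟩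
  · have hω := ω.continuous_coe
    -- After `t₀` the uniform bound is below `ε` for every initial state. Before `t₀` the flow is
    -- dominated by `|x|` times a growth factor bounded by `M`, whence `η = ε / (M + 1)`.
    obtain ⟨t₀, ht₀⟩ := eventually_atTop.1
      ((eventually_abs_bernoulliCocycle_pullback_le (lam := lam) hβ hpos τ ω).and
        ((tendsto_upperBound_zero hβ hβ₀ hlow hlam τ ω).eventually (gt_mem_nhds hε)))
    have hc : Continuous fun t : ℝ => Real.exp (lam * t - δ * ω.1 (-t)) := by fun_prop
    obtain ⟨M, hM⟩ := (isCompact_Icc (a := (0 : ℝ)) (b := t₀)).exists_bound_of_continuousOn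
      hc.continuousOn
    have hM0 : 0 ≤ M := (norm_nonneg _).trans (hM 0 (left_mem_Icc.2 t₀.2))
    refine ⟨ε / (M + 1), by positivity, fun t => ?_⟩
    rintro _ ⟨x, ⟨hx, -⟩, rfl⟩
    refine ⟨?_, mem_univ _⟩
    rw [mem_ball_zero_iff, Real.norm_eq_abs] at hx ⊢
    rcases le_total t₀ t with h | h
    · exact ((ht₀ t h).1 x).trans_lt (ht₀ t h).2
    · have h1 := hM t ⟨t.2, NNReal.coe_le_coe.2 h⟩
      rw [Real.norm_eq_abs] at h1
      rw [bernoulliCocycle_pullback]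
      refine (abs_div_sqrt_le_abs (recentMass_nonneg hpos t.2 τ ω) _).trans_lt ?_
      rw [abs_mul]
      rw [lt_div_iff₀ (by positivity)] at hx
      have h2 := mul_le_mul_of_nonneg_left h1 (abs_nonneg x)
      have h3 := abs_nonneg x
      by_cases hx0 : |x| = 0
      · simpa [hx0] using hε
      · have : 0 < |x| := lt_of_le_of_ne h3 (Ne.symm hx0)
        linarith
  · refine squeeze_zero_norm' ?_ (tendsto_upperBound_zero hβ hβ₀ hlow hlam τ ω)
    filter_upwards [eventually_abs_bernoulliCocycle_pullback_le (lam := lam) hβ hpos τ ω]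
      with t ht
    exact ht x

theorem bernoulliCocycle_isPullbackAttractor_zero (hβ : Continuous β) (hβ₀ : 0 < β₀)
    (hlow : ∀ s, β₀ ≤ β s) (hlam : lam ≤ 0) :
    IsPullbackAttractor (bernoulliCocycle (δ := δ) β lam) fun _ _ => {0} where
  tempered :=
    { nonempty := fun _ _ => singleton_nonempty 0
      bounded := fun _ _ => Bornology.isBounded_singleton
      tendsto := fun c _ τ ω => by simp }
  measurable _ _ := measurable_const
  compact _ _ := isCompact_singleton
  invariant t τ ω := by rw [image_singleton, bernoulliCocycle_isFixedPoint_zero]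
  attracts B _ τ ω := by
    refine tendsto_hausdorffSemiDist_zero (tendsto_upperBound_zero hβ hβ₀ hlow hlam τ ω) ?_
    filter_upwards [eventually_abs_bernoulliCocycle_pullback_le (lam := lam) hβ
      (fun s => hβ₀.trans_le (hlow s)) τ ω] with t ht
    rintro _ ⟨x, -, rfl⟩
    exact ⟨0, mem_singleton _, by simpa using ht x⟩

theorem monotone_bernoulliCocycle (hpos : ∀ s, 0 < β s) (t : ℝ≥0) (τ : ℝ) (ω : SamplePath δ) :
    Monotone (bernoulliCocycle β lam t τ ω) := by
  have h := monotone_div_sqrt (integral_bernoulliWeight_nonneg (δ := δ) (lam := lam)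
    (w := fun s => ω.1 s) (fun s => hpos (τ + s)) t.2)
  intro x y hxy
  have h1 := mul_le_mul_of_nonneg_right (h hxy) (Real.exp_pos (lam * t + δ * ω.1 t)).le
  simp only [div_mul_eq_mul_div] at h1
  exact h1

theorem tendsto_upperBound_nnreal (hδ : 0 < δ) (hlam : 0 < lam) (hβ : Continuous β)
    (hpos : ∀ s, 0 < β s) (hup : ∀ s, β s ≤ β₁) (τ : ℝ) (ω : SamplePath δ) :
    Tendsto (fun t : ℝ≥0 => 1 / √(2 * recentMass β lam τ ω t)) atTop
      (𝓝 (positiveEquilibrium β lam τ ω)) :=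
  (tendsto_upperBound hδ hlam hβ hpos hup τ ω).comp (NNReal.tendsto_coe_atTop.2 tendsto_id)

theorem bernoulliCocycle_isPullbackUnstable [Nonempty (SamplePath δ)] (hδ : 0 < δ)
    (hlam : 0 < lam) (hβ : Continuous β) (hpos : ∀ s, 0 < β s) (hup : ∀ s, β s ≤ β₁) :
    IsPullbackUnstableFixedPoint (bernoulliCocycle (δ := δ) β lam) univ 0 := by
  refine ⟨bernoulliCocycle_isFixedPoint_zero, fun hstab => ?_⟩
  obtain ⟨ω⟩ := ‹Nonempty (SamplePath δ)›
  have hx := positiveEquilibrium_pos hδ hlam hβ hpos hup 0 ω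
  -- Stability is tested with half the equilibrium as `ε`: the initial state `η/2` is pulled to the
  -- whole equilibrium.
  obtain ⟨η, hη, h⟩ := hstab 0 ω _ (half_pos hx)
  have h1 : positiveEquilibrium β lam 0 ω ≤ positiveEquilibrium β lam 0 ω / 2 := by
    refine le_of_tendsto'
      (tendsto_bernoulliCocycle_pullback hδ hlam hβ hpos hup 0 ω (half_pos hη)) fun t => ?_
    have h2 := (h t ⟨η / 2, ⟨?_, mem_univ _⟩, rfl⟩).1
    · rw [mem_ball_zero_iff, Real.norm_eq_abs] at h2
      exact (le_abs_self _).trans h2.le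
    · rw [mem_ball_zero_iff, Real.norm_eq_abs, abs_of_pos (half_pos hη)]
      exact half_lt_self hη
  linarith

theorem bernoulliCocycle_isPullbackAttractor_Icc (hδ : 0 < δ)
    (hlam : 0 < lam) (hβ : Continuous β) (hβ₀ : 0 < β₀) (hlow : ∀ s, β₀ ≤ β s)
    (hup : ∀ s, β s ≤ β₁) :
    IsPullbackAttractor (bernoulliCocycle (δ := δ) β lam) fun τ ω =>
      Icc (-positiveEquilibrium β lam τ ω) (positiveEquilibrium β lam τ ω) := by
  have hpos : ∀ s, 0 < β s := fun s => hβ₀.trans_le (hlow s)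
  have hx := fun τ (ω : SamplePath δ) => positiveEquilibrium_pos hδ hlam hβ hpos hup τ ω
  have hle := fun τ (ω : SamplePath δ) => neg_le_self (hx τ ω).le
  have hq := positiveEquilibrium_isCompleteQuasiSolution (δ := δ) hδ hlam hβ hpos hup
  refine ⟨⟨fun τ ω => nonempty_Icc.2 (hle τ ω), fun τ ω => Metric.isBounded_Icc _ _,
    fun c hc τ ω => ?_⟩, fun τ x => ?_, fun τ ω => isCompact_Icc, fun t τ ω => ?_,
    fun B _ τ ω => ?_⟩
  · refine (tendsto_exp_mul_positiveEquilibrium_shift hδ hlam hβ hβ₀ hlow hup hc τ ω).congr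
      fun t => ?_
    congr 1
    have hg : IsGreatest ((fun x => |x|) '' Icc
        (-positiveEquilibrium β lam (τ + t) (ω.shift t))
        (positiveEquilibrium β lam (τ + t) (ω.shift t)))
        (positiveEquilibrium β lam (τ + t) (ω.shift t)) := by
      refine ⟨⟨_, right_mem_Icc.2 (hle _ _), abs_of_pos (hx _ _)⟩, ?_⟩
      rintro _ ⟨y, hy, rfl⟩
      exact abs_le.2 hy
    exact hg.csSup_eq.symm
  · simp_rw [infDist_Icc (hle τ _)]
    have := measurable_positiveEquilibrium (δ := δ) hβ lam τ
    fun_prop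
  -- A continuous monotone map sends an interval onto the interval between the images of its end
  -- points, and both end points are quasi-solutions.
  · rw [ContinuousOn.image_Icc_of_monotoneOn (hle τ ω)
      (((bernoulliCocycle_isContinuousCocycle hβ hpos).continuous t τ ω).continuousOn)
      ((monotone_bernoulliCocycle hpos t τ ω).monotoneOn _), hq.neg t τ ω, hq t τ ω]
  -- The uniform bound tends to the equilibrium itself, so the excess over the interval is at most
  -- their difference.
  · have h1 := ((tendsto_upperBound_nnreal hδ hlam hβ hpos hup τ ω).sub_const
      (positiveEquilibrium β lam τ ω)).abs
    rw [sub_self, abs_zero] at h1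
    refine tendsto_hausdorffSemiDist_zero h1 ?_
    filter_upwards [eventually_abs_bernoulliCocycle_pullback_le (lam := lam) hβ hpos τ ω]
      with t ht
    rintro _ ⟨x, -, rfl⟩
    have h2 := abs_le.1 (ht x)
    have h3 := hx τ ω
    generalize bernoulliCocycle β lam t (τ - t) (ω.shift (-t)) x = y at h2 ⊢
    generalize 1 / √(2 * recentMass β lam τ ω t) = u at h2 ⊢
    generalize positiveEquilibrium β lam τ ω = v at h3 ⊢
    refine ⟨max (-v) (min y v), ⟨le_max_left _ _, max_le (by linarith) (min_le_right _ _)⟩, ?_⟩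
    grind

theorem pullbackAttractsCompacts_Ioi (hδ : 0 < δ) (hlam : 0 < lam) (hβ : Continuous β)
    (hpos : ∀ s, 0 < β s) (hup : ∀ s, β s ≤ β₁) :
    PullbackAttractsCompacts (bernoulliCocycle (δ := δ) β lam) (positiveEquilibrium β lam)
      (Ioi 0) := by
  intro K hK hKc τ ω
  rcases K.eq_empty_or_nonempty with rfl | hne
  · simp [hausdorffSemiDist]
  -- By monotonicity every image lies between that of the least element `k > 0` and the uniform
  -- bound, and both converge to the equilibrium.
  obtain ⟨k, hkK, hk⟩ := hKc.exists_isLeast hne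
  have hk0 : 0 < k := hK hkK
  have h1 := ((tendsto_bernoulliCocycle_pullback hδ hlam hβ hpos hup τ ω hk0).sub_const
    (positiveEquilibrium β lam τ ω)).abs
  have h2 := ((tendsto_upperBound_nnreal hδ hlam hβ hpos hup τ ω).sub_const
    (positiveEquilibrium β lam τ ω)).abs
  rw [sub_self, abs_zero] at h1 h2
  have h3 := h1.add h2
  rw [add_zero] at h3
  refine tendsto_hausdorffSemiDist_zero h3 ?_
  filter_upwards [eventually_abs_bernoulliCocycle_pullback_le (lam := lam) hβ hpos τ ω]
    with t ht
  rintro _ ⟨x, hx, rfl⟩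
  refine ⟨_, mem_singleton _, ?_⟩
  have h4 := (abs_le.1 (ht x)).2
  have h5 := monotone_bernoulliCocycle (lam := lam) hpos t (τ - t) (ω.shift (-t)) (hk hx)
  grind

theorem pullbackAttractsCompacts_neg {ξ : ℝ → SamplePath δ → ℝ}
    (h : PullbackAttractsCompacts (bernoulliCocycle (δ := δ) β lam) ξ (Ioi 0)) :
    PullbackAttractsCompacts (bernoulliCocycle (δ := δ) β lam) (fun τ ω => -ξ τ ω) (Iio 0) := by
  intro K hK hKc τ ω
  have h1 := h (Neg.neg '' K) (by
    rintro _ ⟨x, hx, rfl⟩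
    exact neg_pos.2 (mem_Iio.1 (hK hx))) (hKc.image continuous_neg) τ ω
  refine h1.congr fun t => ?_
  simp only [hausdorffSemiDist, iSup_image, Metric.infEDist_singleton]
  refine iSup_congr fun x => iSup_congr fun _ => ?_
  rw [show bernoulliCocycle β lam t (τ - t) (ω.shift (-t)) (-x) =
    -bernoulliCocycle β lam t (τ - t) (ω.shift (-t)) x from bernoulliFlow_neg _ _,
    edist_dist, edist_dist, Real.dist_eq, Real.dist_eq, ← abs_neg]
  congr 2
  ring

end Bifurcation

theorem theorem3p6 (P : Measure WienerSpace) (hP : IsWienerMeasure P)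
    (δ : ℝ) (hδ : 0 < δ)
    (β : ℝ → ℝ) (hβ_smooth : ContDiff ℝ (⊤ : ℕ∞) β)
    (β₀ β₁ : ℝ) (hβ₀ : 0 < β₀) (hβ : ∀ t, β₀ ≤ β t ∧ β t ≤ β₁)
    (κ : RecurrenceType) (hκ : κ.Holds β) :
    -- the regular paths have full measure
    (MeasurableSet (regularPaths δ) ∧ P (regularPaths δ) = 1) ∧
    -- the equation generates a unique continuous cocycle for each `λ`
    (∀ lam : ℝ, ∃! φ : CocycleMap δ, IsGeneratedCocycle (sampleMeasure P δ) β lam φ) ∧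
    ∀ Φ : ℝ → CocycleMap δ,
      (∀ lam, IsGeneratedCocycle (sampleMeasure P δ) β lam (Φ lam)) →
      -- (i)
      (∀ lam ≤ 0,
        IsRecurrentSolution κ (Φ lam) (fun _ _ => 0) ∧
        (∀ κ' ξ, IsRecurrentSolution κ' (Φ lam) ξ → ξ = fun _ _ => 0) ∧
        IsPullbackAsympStableFixedPoint (Φ lam) univ 0 ∧
        IsPullbackAttractor (Φ lam) (fun _ _ => {0})) ∧
      -- (ii)
      ∃ xp xm : ℝ → ℝ → SamplePath δ → ℝ,
        (∀ lam > 0,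
          IsPullbackUnstableFixedPoint (Φ lam) univ 0 ∧
          (∀ τ, Measurable (xp lam τ) ∧ Measurable (xm lam τ)) ∧
          (∀ τ ω, 0 < xp lam τ ω ∧ xm lam τ ω < 0) ∧
          IsRecurrentSolution κ (Φ lam) (xp lam) ∧
          IsRecurrentSolution κ (Φ lam) (xm lam) ∧
          IsPullbackAttractor (Φ lam) (fun τ ω => Icc (xm lam τ ω) (xp lam τ ω)) ∧
          PullbackAttractsCompacts (Φ lam) (xp lam) (Ioi 0) ∧
          PullbackAttractsCompacts (Φ lam) (xm lam) (Iio 0)) ∧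
        ∀ τ ω, Tendsto (fun lam => xp lam τ ω) (𝓝[>] 0) (𝓝 0) ∧
          Tendsto (fun lam => xm lam τ ω) (𝓝[>] 0) (𝓝 0) := by
  have hc : Continuous β := hβ_smooth.continuous
  have hlow : ∀ s, β₀ ≤ β s := fun s => (hβ s).1
  have hup : ∀ s, β s ≤ β₁ := fun s => (hβ s).2
  have hpos : ∀ s, 0 < β s := fun s => hβ₀.trans_le (hlow s)
  have hQ := hP.isProbabilityMeasure_sampleMeasure hδ.le
  have hgen : ∀ lam : ℝ,
      IsGeneratedCocycle (sampleMeasure P δ) β lam (bernoulliCocycle β lam) := fun lam =>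
    bernoulliCocycle_isGeneratedCocycle (fun s t hst => hP.hasLaw_sampleMeasure hδ.le hst) hc hpos
  -- Instability denies a statement about all paths, so at least one regular path must exist.
  have hne : Nonempty (SamplePath δ) :=
    nonempty_of_measure_ne_zero (μ := P) (s := regularPaths δ)
      (by simp [hP.measure_regularPaths hδ.le]) |>.to_subtype
  refine ⟨⟨measurableSet_regularPaths δ, hP.measure_regularPaths hδ.le⟩,
    fun lam => ⟨_, hgen lam, fun φ hφ => hφ.eq_bernoulliCocycle hc hpos⟩, fun Φ hΦ => ?_⟩
  obtain rfl : Φ = bernoulliCocycle β := funext fun lam => (hΦ lam).eq_bernoulliCocycle hc hpos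
  refine ⟨fun lam hlam => ⟨⟨fun t τ ω => bernoulliCocycle_isFixedPoint_zero t τ ω,
    fun _ => hκ.const_zero⟩, fun _ _ hξ => hξ.1.eq_zero_of_nonpos hc hβ₀ hlow hlam,
    bernoulliCocycle_isPullbackAsympStable hc hβ₀ hlow hlam,
    bernoulliCocycle_isPullbackAttractor_zero hc hβ₀ hlow hlam⟩,
    positiveEquilibrium β, fun lam τ ω => -positiveEquilibrium β lam τ ω,
    fun lam hlam => ?_, fun τ ω => ?_⟩
  · have hx := fun τ (ω : SamplePath δ) => positiveEquilibrium_pos hδ hlam hc hpos hup τ ω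
    have hm := fun τ => measurable_positiveEquilibrium (δ := δ) hc lam τ
    have hq := positiveEquilibrium_isCompleteQuasiSolution (δ := δ) hδ hlam hc hpos hup
    have hr := hκ.positiveEquilibrium hδ hlam hc hβ₀ hβ
    have ha := pullbackAttractsCompacts_Ioi hδ hlam hc hpos hup
    exact ⟨bernoulliCocycle_isPullbackUnstable hδ hlam hc hpos hup,
      fun τ => ⟨hm τ, (hm τ).neg⟩, fun τ ω => ⟨hx τ ω, neg_lt_zero.2 (hx τ ω)⟩,
      ⟨hq, fun ω => (hr ω).1⟩, ⟨hq.neg, fun ω => (hr ω).2⟩,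
      bernoulliCocycle_isPullbackAttractor_Icc hδ hlam hc hβ₀ hlow hup,
      ha, pullbackAttractsCompacts_neg ha⟩
  · have h := tendsto_positiveEquilibrium_zero hδ hc hβ₀ hlow hup τ ω
    exact ⟨h, by simpa using h.neg⟩
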